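/- Let $(X,\mu)$ be a $\sigma$-finite measure space, $V$ a separable complex Hilbert space, and $A$ a (possibly unbounded, not necessarily semi-bounded) self-adjoint operator on $\mathcal H=L^2(X,\mu;V)$. Let $\tau$ be the operator trace, and for $\lambda\in\mathbb R$ let $\Pi_\lambda=\mathbf 1_{]-\infty,\lambda[}(A)$. For a measurable set $\Omega\subset X$, with $\chi_\Omega$ the multiplication by its indicator function, put $$F_\Omega(\lambda)=\tau(\Pi_\lambda\chi_\Omega\Pi_\lambda)\in[0,+\infty],\qquad F_\Omega^{-1}(u)=\sup\{\lambda\in\mathbb R\mid F_\Omega(\lambda)\le u\}\in[-\infty,+\infty],\qquad \varphi_\Omega(y)=\int_0^yF_\Omega^{-1}(u)\,du .$$ A state is a positive trace class operator $\rho$ on $\mathcal H$; it is supported in $\Omega$ if every function in its range vanishes almost everywhere outside $\Omega$. Put $\mathcal E^{\pm}(\rho)=\tau(\rho^{1/2}\max(\pm A,0)\rho^{1/2})\in[0,+\infty]$ and, when $\mathcal E^+(\rho)<\infty$, let $\mathcal E(\rho)=\mathcal E^+(\rho)-\mathcal E^-(\rho)\in[-\infty,+\infty[$ be the energy $\tau(\rho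 A)$ of $\rho$. Let $\|\rho\|_\infty$ be the operator norm of $\rho$. **Theorem.** (1) Let $\rho$ be a non-zero state supported in $\Omega$ with $\mathcal E^+(\rho)<\infty$. Then the positive part of $F_\Omega^{-1}$ has a finite integral over $]0,\tau(\rho)/\|\rho\|_\infty[$, so that $\varphi_\Omega(\tau(\rho)/\|\rho\|_\infty)\in[-\infty,+\infty[$ is well defined, and $$\|\rho\|_\infty\,\varphi_\Omega\Bigl(\frac{\tau(\rho)}{\|\rho\|_\infty}\Bigr)\le\mathcal E(\rho).$$ (2) Let $n\ge1$ and let $A=\Delta=-\sum_j\partial_j^2$ on $L^2(\mathbb R^n)$, with domain the $f\in L^2$ whose distributional Laplacian is in $L^2$. This operator is self-adjoint. Let $\Omega\subset\mathbb R^n$ be a measurable set of finite positive volume. For $k\ge1$ let $$\lambda_k(\Omega)=\inf_{L}\ \max_{f\in L,\ \|f\|_2=1}\mathcal E(f)\in[0,+\infty],$$ where $L$ runs over the $k$-dimensional spaces of functions in $L^2(\mathbb R^n)$ of finite energy that vanish almost everywhere outside $\Omega$ (the infimum of the empty set is $+\infty$), and $\mathcal E(f)=\langle\Delta f,f\rangle$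 in the sense of quadratic forms. Then for every integer $N\ge0$ $$\sum_{k=1}^N\lambda_k(\Omega)\ \ge\ \frac{n}{n+2}\,\bigl(C_n\operatorname{vol}(\Omega)\bigr)^{-2/n}N^{1+2/n},\qquad C_n=(2\pi)^{-n}\operatorname{vol}(B_n(0,1)).$$ -/

import Mathlib

open MeasureTheory Set
open scoped ENNReal InnerProductSpace

noncomputable section

namespace ConfinedState

/-! ### Spectral projections of a self-adjoint operator -/

section Spectral

variable {H : Type*} [NormedAddCommGroup H] [InnerProductSpace ℂ H] [CompleteSpace H]

/-- `R` is the bounded inverse `(A + i)⁻¹` of `A + i`. -/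
def IsResolventI (A : H →ₗ.[ℂ] H) (R : H →L[ℂ] H) : Prop :=
  (∀ y : H, ∃ hy : R y ∈ A.domain, A ⟨R y, hy⟩ + Complex.I • R y = y) ∧
    ∀ x : A.domain, R (A x + Complex.I • (x : H)) = x

/-- `A + i` has a bounded inverse defined on the whole space when `A` is self-adjoint. -/
theorem exists_isResolventI {A : H →ₗ.[ℂ] H} (hA : IsSelfAdjoint A) :
    ∃ R : H →L[ℂ] H, IsResolventI A R := by
  have hd := hA.dense_domain
  have hadj : A.adjoint = A := LinearPMap.isSelfAdjoint_def.1 hA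
  have hsym : ∀ x y : A.domain, ⟪A x, (y : H)⟫_ℂ = ⟪(x : H), A y⟫_ℂ := by
    have h := LinearPMap.adjoint_isFormalAdjoint hd
    rw [hadj] at h
    exact fun x y => h x y
  have him : ∀ x : A.domain, (⟪(x : H), A x⟫_ℂ).im = 0 := by
    intro x
    have h := hsym x x
    rw [← inner_conj_symm] at h
    exact Complex.conj_eq_iff_im.1 h
  have hnorm : ∀ x : A.domain, ‖A x + Complex.I • (x : H)‖ ^ 2 = ‖A x‖ ^ 2 + ‖(x : H)‖ ^ 2 := by
    intro x
    have h := him x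
    have h2 : (⟪A x, (x : H)⟫_ℂ).im = 0 := by rw [hsym]; exact h
    rw [@norm_add_sq ℂ, inner_smul_right, norm_smul]
    simp [h2]
  have : CompleteSpace A.graph := hA.isClosed.completeSpace_coe
  let L : A.graph →L[ℂ] H :=
    (ContinuousLinearMap.snd ℂ H H + Complex.I • ContinuousLinearMap.fst ℂ H H).comp
      A.graph.subtypeL
  have hL : ∀ x : A.domain, L ⟨(x, A x), A.mem_graph x⟩ = A x + Complex.I • (x : H) :=
    fun x => rfl
  have hex : ∀ p : A.graph, ∃ x : A.domain, p = ⟨(x, A x), A.mem_graph x⟩ := by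
    rintro ⟨⟨a, b⟩, hp⟩
    obtain ⟨x, hx, hx'⟩ := (A.mem_graph_iff).1 hp
    exact ⟨x, Subtype.ext (Prod.ext hx.symm hx'.symm)⟩
  have hanti : AntilipschitzWith 1 L := by
    refine ContinuousLinearMap.antilipschitz_of_bound L fun p => ?_
    obtain ⟨x, rfl⟩ := hex p
    rw [hL, NNReal.coe_one, one_mul]
    have h := hnorm x
    have h1 : ‖(x : H)‖ ≤ ‖A x + Complex.I • (x : H)‖ :=
      (abs_le_of_sq_le_sq' (by rw [h]; exact le_add_of_nonneg_left (sq_nonneg _)) (norm_nonneg _)).2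
    have h2 : ‖A x‖ ≤ ‖A x + Complex.I • (x : H)‖ :=
      (abs_le_of_sq_le_sq' (by rw [h]; exact le_add_of_nonneg_right (sq_nonneg _)) (norm_nonneg _)).2
    exact max_le h1 h2
  have hker : L.ker = ⊥ := LinearMap.ker_eq_bot.2 hanti.injective
  have hclosed : IsClosed (L.range : Set H) := hanti.isClosed_range L.uniformContinuous
  have hrange : L.range = ⊤ := by
    have : CompleteSpace L.range := hclosed.completeSpace_coe
    rw [← Submodule.orthogonal_eq_bot_iff, Submodule.eq_bot_iff]
    intro y hy
    rw [Submodule.mem_orthogonal'] at hy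
    have h1 : ∀ x : A.domain, ⟪Complex.I • y, (x : H)⟫_ℂ = ⟪y, A x⟫_ℂ := by
      intro x
      have h := hy _ (LinearMap.mem_range_self _ (⟨(x, A x), A.mem_graph x⟩ : A.graph))
      have h' : ⟪y, A x + Complex.I • (x : H)⟫_ℂ = 0 := h
      rw [inner_add_right, inner_smul_right] at h'
      rw [inner_smul_left, Complex.conj_I]
      linear_combination -h'
    have hyd : y ∈ A.adjoint.domain := A.mem_adjoint_domain_of_exists y ⟨_, h1⟩
    have hAy : A.adjoint ⟨y, hyd⟩ = Complex.I • y := LinearPMap.adjoint_apply_eq hd ⟨y, hyd⟩ h1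
    have key : ∀ B : H →ₗ.[ℂ] H, B = A → ∀ h : y ∈ B.domain, B ⟨y, h⟩ = Complex.I • y → y = 0 := by
      rintro B rfl h hB
      have := him ⟨y, h⟩
      rw [hB, inner_smul_right, inner_self_eq_norm_sq_to_K] at this
      simpa [← Complex.ofReal_pow] using this
    exact key _ hadj hyd hAy
  let e := ContinuousLinearEquiv.ofBijective L hker hrange
  refine ⟨((ContinuousLinearMap.fst ℂ H H).comp A.graph.subtypeL).comp
    (e.symm : H →L[ℂ] A.graph), fun y => ?_, fun x => ?_⟩
  · obtain ⟨x, hx⟩ := hex (e.symm y)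
    have hy : y = e (e.symm y) := (e.apply_symm_apply y).symm
    have h1 : (((ContinuousLinearMap.fst ℂ H H).comp A.graph.subtypeL).comp
        (e.symm : H →L[ℂ] A.graph)) y = x := by
      change ((e.symm y : A.graph) : H × H).1 = x
      rw [hx]
    have h2 : y = A x + Complex.I • (x : H) := by
      rw [hx] at hy
      exact hy
    refine ⟨by rw [h1]; exact x.2, ?_⟩
    simp only [h1]
    exact h2.symm
  · change ((e.symm (A x + Complex.I • (x : H)) : A.graph) : H × H).1 = x
    have : A x + Complex.I • (x : H) = e ⟨(x, A x), A.mem_graph x⟩ := rfl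
    rw [this, e.symm_apply_apply]

open scoped Classical in
/-- The resolvent `(A + i)⁻¹` of a self-adjoint operator `A` (and `0` if it does not exist). -/
def resolventI (A : H →ₗ.[ℂ] H) : H →L[ℂ] H :=
  if h : ∃ R, IsResolventI A R then h.choose else 0

theorem isResolventI_resolventI {A : H →ₗ.[ℂ] H} (hA : IsSelfAdjoint A) :
    IsResolventI A (resolventI A) := by
  have h := exists_isResolventI hA
  rw [resolventI, dif_pos h]
  exact h.choose_spec

/-- The bounded positive operator `max(l - A, 0) (1 + A²)⁻¹`, as a continuous function of the
bounded normal operator `R = (A + i)⁻¹`: for `z = (a + i)⁻¹`, `a` real, one has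
`l ‖z‖² - re z = (l - a) / (1 + a²)`. -/
def lowerCutoff (A : H →ₗ.[ℂ] H) (l : ℝ) : H →L[ℂ] H :=
  cfc (fun z : ℂ => ((max (l * ‖z‖ ^ 2 - z.re) 0 : ℝ) : ℂ)) (resolventI A)

/-- The range of the spectral projection of `A` on `]-∞, l[`: since the function
`a ↦ max(l - a, 0) / (1 + a²)` is positive exactly on `]-∞, l[`, this is the closure of the range
of the operator `max(l - A, 0) (1 + A²)⁻¹`. -/
def lowerSpectralSpace (A : H →ₗ.[ℂ] H) (l : ℝ) : Submodule ℂ H :=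
  (lowerCutoff A l).range.topologicalClosure

instance (A : H →ₗ.[ℂ] H) (l : ℝ) : CompleteSpace (lowerSpectralSpace A l) :=
  (lowerCutoff A l).range.isClosed_topologicalClosure.completeSpace_coe

/-- The spectral projection `Π_l` of `A` on `]-∞, l[`. -/
def spectralProj (A : H →ₗ.[ℂ] H) (l : ℝ) : H →L[ℂ] H :=
  (lowerSpectralSpace A l).starProjection

open scoped ComplexOrder in
theorem lowerCutoff_nonneg (A : H →ₗ.[ℂ] H) (l : ℝ) : 0 ≤ lowerCutoff A l :=
  cfc_nonneg fun z _ => by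
    simp only [Complex.zero_le_real]
    exact le_max_right _ _

open scoped ComplexOrder in
theorem lowerCutoff_mono (A : H →ₗ.[ℂ] H) : Monotone (lowerCutoff A) := by
  intro l m hlm
  refine cfc_mono (fun z _ => ?_) (by fun_prop) (by fun_prop)
  simp only [Complex.real_le_real]
  gcongr

theorem lowerSpectralSpace_mono (A : H →ₗ.[ℂ] H) : Monotone (lowerSpectralSpace A) := by
  intro l m hlm
  have hl := (ContinuousLinearMap.nonneg_iff_isPositive _).1 (lowerCutoff_nonneg A l)
  have hm := (ContinuousLinearMap.nonneg_iff_isPositive _).1 (lowerCutoff_nonneg A m)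
  have hd : (lowerCutoff A m - lowerCutoff A l).IsPositive :=
    (ContinuousLinearMap.le_def _ _).1 (lowerCutoff_mono A hlm)
  have hker : ∀ x, lowerCutoff A m x = 0 → lowerCutoff A l x = 0 := by
    intro x hx
    have h1 := hd.re_inner_nonneg_left x
    have h2 := hl.re_inner_nonneg_left x
    rw [sub_apply, hx, zero_sub, inner_neg_left, map_neg] at h1
    have h3 : RCLike.re ⟪lowerCutoff A l x, x⟫_ℂ = 0 := le_antisymm (by linarith) h2
    obtain ⟨S, hS⟩ : ∃ S : H →L[ℂ] H, lowerCutoff A l = star S * S :=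
      CStarAlgebra.nonneg_iff_eq_star_mul_self.1 (lowerCutoff_nonneg A l)
    have h4 : S x = 0 := by
      rw [hS, ContinuousLinearMap.star_eq_adjoint, mul_apply_eq_comp,
        ContinuousLinearMap.adjoint_inner_left, inner_self_eq_norm_sq] at h3
      simpa using h3
    rw [hS, mul_apply_eq_comp, h4, map_zero]
  have horth : ∀ k, (lowerSpectralSpace A k)ᗮ = (lowerCutoff A k).ker := by
    intro k
    have hk := (ContinuousLinearMap.nonneg_iff_isPositive _).1 (lowerCutoff_nonneg A k)
    rw [lowerSpectralSpace, Submodule.orthogonal_closure, ContinuousLinearMap.orthogonal_range,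
      hk.isSelfAdjoint.adjoint_eq]
  have h := Submodule.orthogonal_le (K₁ := (lowerSpectralSpace A m)ᗮ)
    (K₂ := (lowerSpectralSpace A l)ᗮ) (by rw [horth, horth]; exact fun x hx => hker x hx)
  rwa [Submodule.orthogonal_orthogonal, Submodule.orthogonal_orthogonal] at h

theorem monotone_norm_sq_spectralProj (A : H →ₗ.[ℂ] H) (f : H) :
    Monotone fun l => ‖spectralProj A l f‖ ^ 2 := by
  intro l m hlm
  have h := Submodule.starProjection_comp_starProjection_of_le (lowerSpectralSpace_mono A hlm)
  have h' : spectralProj A l f = (lowerSpectralSpace A l).starProjection (spectralProj A m f) :=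
    (congrArg (fun T : H →L[ℂ] H => T f) h).symm
  have := (lowerSpectralSpace A l).norm_starProjection_apply_le (spectralProj A m f)
  rw [← h'] at this
  simp only
  gcongr

/-- The scalar spectral measure `μ_f(B) = ⟨1_B(A) f, f⟩` of `A` at `f`: the Lebesgue–Stieltjes
measure of the function `l ↦ ⟨Π_l f, f⟩ = ‖Π_l f‖²`. -/
def spectralMeasureAt (A : H →ₗ.[ℂ] H) (f : H) : Measure ℝ :=
  (monotone_norm_sq_spectralProj A f).stieltjesFunction.measure

/-- The closed quadratic form `⟨max(A,0) f, f⟩ ∈ [0, ∞]` of the positive part of `A`. -/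
def posForm (A : H →ₗ.[ℂ] H) (f : H) : ℝ≥0∞ :=
  ∫⁻ t, ENNReal.ofReal t ∂(spectralMeasureAt A f)

/-- The closed quadratic form `⟨max(-A,0) f, f⟩ ∈ [0, ∞]` of the negative part of `A`. -/
def negForm (A : H →ₗ.[ℂ] H) (f : H) : ℝ≥0∞ :=
  ∫⁻ t, ENNReal.ofReal (-t) ∂(spectralMeasureAt A f)

/-- The energy `E(f) = ⟨A f, f⟩ ∈ [-∞, ∞[` of a function with `posForm A f < ∞`. -/
def formEnergy (A : H →ₗ.[ℂ] H) (f : H) : EReal :=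
  (posForm A f : EReal) - (negForm A f : EReal)

/-! ### Traces and energies of states -/

variable (H) in
/-- A Hilbert basis of `H`; traces of positive operators do not depend on it. -/
def basis : HilbertBasis (exists_hilbertBasis ℂ H).choose ℂ H :=
  (exists_hilbertBasis ℂ H).choose_spec.choose

/-- The trace `τ(P) ∈ [0, ∞]` of a bounded positive operator. -/
def trace (P : H →L[ℂ] H) : ℝ≥0∞ :=
  ∑' i, ENNReal.ofReal (RCLike.re ⟪P (basis H i), basis H i⟫_ℂ)

/-- A state: a positive trace class operator. -/
structure IsState (ρ : H →L[ℂ] H) : Prop where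
  isPositive : ρ.IsPositive
  trace_ne_top : trace ρ ≠ ∞

/-- `E⁺(ρ) = τ(ρ^{1/2} max(A,0) ρ^{1/2})`. -/
def posEnergy (A : H →ₗ.[ℂ] H) (ρ : H →L[ℂ] H) : ℝ≥0∞ :=
  ∑' i, posForm A (CFC.sqrt ρ (basis H i))

/-- `E⁻(ρ) = τ(ρ^{1/2} max(-A,0) ρ^{1/2})`. -/
def negEnergy (A : H →ₗ.[ℂ] H) (ρ : H →L[ℂ] H) : ℝ≥0∞ :=
  ∑' i, negForm A (CFC.sqrt ρ (basis H i))

/-- The energy `E(ρ) = τ(ρ A) = τ(ρ^{1/2} A ρ^{1/2}) ∈ [-∞, ∞[` of a state with `E⁺(ρ) < ∞`. -/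
def energy (A : H →ₗ.[ℂ] H) (ρ : H →L[ℂ] H) : EReal :=
  (posEnergy A ρ : EReal) - (negEnergy A ρ : EReal)

end Spectral

/-! ### Localization in a subset of the ambient space -/

/-- The function `χ_Ω f`. -/
def indicatorLp {X V : Type*} [MeasurableSpace X] {μ : Measure X} [NormedAddCommGroup V]
    {Ω : Set X} (hΩ : MeasurableSet Ω) (f : Lp V 2 μ) : Lp V 2 μ :=
  MemLp.toLp (Ω.indicator f) ((Lp.memLp f).indicator hΩ)

theorem coeFn_indicatorLp {X V : Type*} [MeasurableSpace X] {μ : Measure X}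
    [NormedAddCommGroup V] {Ω : Set X} (hΩ : MeasurableSet Ω) (f : Lp V 2 μ) :
    indicatorLp hΩ f =ᵐ[μ] Ω.indicator f :=
  MemLp.coeFn_toLp _

section Space

variable {X : Type*} [MeasurableSpace X] {μ : Measure X}
  {V : Type*} [NormedAddCommGroup V] [InnerProductSpace ℂ V]

/-- `f` vanishes almost everywhere outside `Ω`. -/
def SupportedIn (Ω : Set X) (f : Lp V 2 μ) : Prop :=
  ∀ᵐ x ∂μ, x ∉ Ω → f x = 0

/-- `ρ` is supported in `Ω`: its range consists of functions supported in `Ω`; for self-adjoint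
`ρ` this is `ρ = χ_Ω ρ χ_Ω`. -/
def IsConfined (Ω : Set X) (ρ : Lp V 2 μ →L[ℂ] Lp V 2 μ) : Prop :=
  ∀ f, SupportedIn Ω (ρ f)

variable (μ V) in
/-- The multiplication operator `χ_Ω` by the indicator function of `Ω`. -/
def indicatorOp {Ω : Set X} (hΩ : MeasurableSet Ω) : Lp V 2 μ →L[ℂ] Lp V 2 μ :=
  LinearMap.mkContinuous
    { toFun := indicatorLp hΩ
      map_add' := fun f g => by
        refine Lp.ext ?_
        filter_upwards [Lp.coeFn_add f g, Lp.coeFn_add (indicatorLp hΩ f) (indicatorLp hΩ g),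
          coeFn_indicatorLp hΩ f, coeFn_indicatorLp hΩ g, coeFn_indicatorLp hΩ (f + g)]
          with x h1 h2 h3 h4 h5
        rw [h5, h2, Pi.add_apply, h3, h4]
        by_cases h : x ∈ Ω
        · simp only [indicator_of_mem h, h1, Pi.add_apply]
        · simp only [indicator_of_notMem h, add_zero]
      map_smul' := fun c f => by
        refine Lp.ext ?_
        filter_upwards [Lp.coeFn_smul c f, Lp.coeFn_smul c (indicatorLp hΩ f),
          coeFn_indicatorLp hΩ f, coeFn_indicatorLp hΩ (c • f)] with x h1 h2 h3 h4
        rw [h4, RingHom.id_apply, h2, Pi.smul_apply, h3]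
        by_cases h : x ∈ Ω
        · simp only [indicator_of_mem h, h1, Pi.smul_apply]
        · simp only [indicator_of_notMem h, smul_zero] }
    1 fun f => by
      rw [one_mul]
      refine Lp.norm_le_norm_of_ae_le ?_
      filter_upwards [coeFn_indicatorLp hΩ f] with x hx
      exact (congrArg norm hx).trans_le (norm_indicator_le_norm_self _ _)

variable [CompleteSpace V]

/-- The spectral measure `F_Ω(l) = τ(Π_l χ_Ω Π_l)` of `Ω`. -/
def spectralCount (A : Lp V 2 μ →ₗ.[ℂ] Lp V 2 μ) {Ω : Set X} (hΩ : MeasurableSet Ω) (l : ℝ) :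
    ℝ≥0∞ :=
  trace (spectralProj A l ∘L indicatorOp μ V hΩ ∘L spectralProj A l)

/-- The pseudo-inverse `F⁻¹(y) = sup {x ∈ ℝ | F(x) ≤ y} ∈ [-∞, ∞]` of an increasing function. -/
def pseudoInv (F : ℝ → ℝ≥0∞) (y : ℝ≥0∞) : EReal :=
  sSup ((fun x : ℝ => (x : EReal)) '' {x | F x ≤ y})

/-- The integral `∫_0^y (F⁻¹)⁺(u) du` of the positive part of `F⁻¹`. -/
def posInvIntegral (F : ℝ → ℝ≥0∞) (y : ℝ) : ℝ≥0∞ :=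
  ∫⁻ u in Ioo 0 y, (pseudoInv F (ENNReal.ofReal u)).toENNReal

/-- The integral `∫_0^y (F⁻¹)⁻(u) du` of the negative part of `F⁻¹`. -/
def negInvIntegral (F : ℝ → ℝ≥0∞) (y : ℝ) : ℝ≥0∞ :=
  ∫⁻ u in Ioo 0 y, (-pseudoInv F (ENNReal.ofReal u)).toENNReal

/-- `φ(y) = ∫_0^y F⁻¹(u) du ∈ [-∞, ∞[`, when the positive part has a finite integral. -/
def invIntegral (F : ℝ → ℝ≥0∞) (y : ℝ) : EReal :=
  (posInvIntegral F y : EReal) - (negInvIntegral F y : EReal)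

/-- The `k`-dimensional spaces of functions supported in `Ω` and of finite positive energy. -/
def trialSpaces (A : Lp V 2 μ →ₗ.[ℂ] Lp V 2 μ) (Ω : Set X) (k : ℕ) :
    Set (Submodule ℂ (Lp V 2 μ)) :=
  {L | FiniteDimensional ℂ L ∧ Module.finrank ℂ L = k ∧
    ∀ f ∈ L, SupportedIn Ω f ∧ posForm A f ≠ ∞}

/-- The `k`-th Dirichlet eigenvalue of `A` in `Ω` (`k ≥ 1`), by the min-max principle: the infimum
over the `k`-dimensional spaces `L` of functions supported in `Ω` of the maximum of
`E(f) / ‖f‖²` on `L`; it is `+∞` when there is no such space of finite positive energy. -/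
def dirichletEigenvalue (A : Lp V 2 μ →ₗ.[ℂ] Lp V 2 μ) (Ω : Set X) (k : ℕ) : EReal :=
  ⨅ L ∈ trialSpaces A Ω k, ⨆ f ∈ {f : Lp V 2 μ | f ∈ L ∧ ‖f‖ = 1}, formEnergy A f

end Space

/-! ### The Laplacian of `ℝⁿ` -/

section Laplacian

open scoped Laplacian SchwartzMap

/-- The graph `{(f, g) | -Δ f = g in the sense of tempered distributions}` in `L²(ℝⁿ)²`. -/
def laplacianGraph (n : ℕ) :
    Submodule ℂ (Lp ℂ 2 (volume : Measure (EuclideanSpace ℝ (Fin n))) ×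
      Lp ℂ 2 (volume : Measure (EuclideanSpace ℝ (Fin n)))) where
  carrier := {p | -Δ (Lp.toTemperedDistributionCLM ℂ volume 2 p.1) =
    Lp.toTemperedDistributionCLM ℂ volume 2 p.2}
  add_mem' := fun {p q} hp hq => by
    simp only [← TemperedDistribution.laplacianCLM_apply, mem_ofPred_eq] at hp hq ⊢
    rw [Prod.fst_add, Prod.snd_add, map_add, map_add, map_add, neg_add, hp, hq]
  zero_mem' := by
    simp only [← TemperedDistribution.laplacianCLM_apply, mem_ofPred_eq]
    rw [Prod.fst_zero, Prod.snd_zero, map_zero, map_zero, neg_zero]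
  smul_mem' := fun c p hp => by
    simp only [← TemperedDistribution.laplacianCLM_apply, mem_ofPred_eq] at hp ⊢
    rw [Prod.smul_fst, Prod.smul_snd, map_smul, map_smul, map_smul, ← smul_neg, hp]

theorem laplacianGraph_isGraph (n : ℕ) :
    ∀ p ∈ laplacianGraph n, p.1 = 0 → p.2 = 0 := by
  rintro ⟨f, g⟩ hp hf
  simp only at hf
  subst hf
  change -Δ (Lp.toTemperedDistributionCLM ℂ volume 2 0) =
    Lp.toTemperedDistributionCLM ℂ volume 2 g at hp
  rw [← TemperedDistribution.laplacianCLM_apply, map_zero, map_zero, neg_zero] at hp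
  have hg : g ∈ (Lp.toTemperedDistributionCLM ℂ
      (volume : Measure (EuclideanSpace ℝ (Fin n))) 2).ker := hp.symm
  rw [Lp.ker_toTemperedDistributionCLM_eq_bot] at hg
  exact hg

/-- The positive Laplacian `-∑ ∂ⱼ²` on `L²(ℝⁿ)`, with domain the `f ∈ L²` whose distributional
Laplacian is in `L²`. -/
def laplacian (n : ℕ) :
    Lp ℂ 2 (volume : Measure (EuclideanSpace ℝ (Fin n))) →ₗ.[ℂ]
      Lp ℂ 2 (volume : Measure (EuclideanSpace ℝ (Fin n))) :=
  (laplacianGraph n).toLinearPMap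

end Laplacian

end ConfinedState

end

/-! Let n(t) = τ(ρ^{1/2} Π_t ρ^{1/2}) (`energyCount`) and y = τ(ρ)/‖ρ‖. The layer-cake formula for
spectral measures gives E⁺(ρ) ≥ ∫_0^∞ (τ(ρ) - n(t)) dt and E⁻(ρ) ≤ ∫_0^∞ n(-t) dt. Always n ≤ τ(ρ),
and confinement gives ρ ≤ ‖ρ‖ χ_Ω, hence n ≤ ‖ρ‖ F_Ω (`energyCount_le`). The energy is least when
the levels are filled from below as far as these bounds allow: E⁺ ≥ ‖ρ‖ ∫ (y - F_Ω(t))⁺ dt and E⁻ ≤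
‖ρ‖ ∫ min(y, F_Ω(-t)) dt. By Tonelli these areas compare with the positive and negative parts of
∫_0^y F_Ω⁻¹ (`posInvIntegral_le`, `le_negInvIntegral`). One inequality suffices at each place, so
part (1) uses of Π_t only that it is monotone and tends strongly to 1 at +∞.

Part (2) applies the layer-cake bound directly to an orthonormal family v_1, ..., v_N supported in
Ω. The value of the Fourier transform of v_i at ξ is the inner product of v_i with a plane wave cut
off to Ω. Bessel's inequality bounds the sum of the squares of these values by vol(Ω), and
integration over 4π²‖ξ‖² < t gives ∑ ‖Π_t v_i‖² ≤ C_n vol(Ω) t^{n/2}. Integrating N minus this bound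
while it is nonnegative produces the constant (`le_sum_posForm_laplacian`). Nearly optimal trial
spaces of dimensions 1, ..., N need not be nested, but contain such a family, one vector in each
(`exists_orthonormal_mem`). The abstract Π_t is tied to the Fourier side by
`lowerCutoff_apply_eq_zero`. -/

noncomputable section

namespace ConfinedState

/-! ### Normality of the resolvent, and layer-cake bounds for spectral measures. -/

section Resolvent

variable {H : Type*} [NormedAddCommGroup H] [InnerProductSpace ℂ H]

theorem IsResolventI.injective {A : H →ₗ.[ℂ] H} {R : H →L[ℂ] H} (hR : IsResolventI A R) {y : H}
    (hy : R y = 0) : y = 0 := by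
  obtain ⟨h, h'⟩ := hR.1 y
  have : (⟨R y, h⟩ : A.domain) = 0 := Subtype.ext hy
  rw [this, LinearPMap.map_zero, hy] at h'
  simpa using h'.symm

variable [CompleteSpace H]

theorem inner_apply_eq_of_isSelfAdjoint {A : H →ₗ.[ℂ] H} (hA : IsSelfAdjoint A) (x y : A.domain) :
    ⟪A x, (y : H)⟫_ℂ = ⟪(x : H), A y⟫_ℂ := by
  have h := LinearPMap.adjoint_isFormalAdjoint hA.dense_domain
  rw [LinearPMap.isSelfAdjoint_def.1 hA] at h
  exact h x y

theorem exists_apply_eq_of_isSelfAdjoint {A : H →ₗ.[ℂ] H} (hA : IsSelfAdjoint A) {y z : H}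
    (h : ∀ x : A.domain, ⟪z, (x : H)⟫_ℂ = ⟪y, A x⟫_ℂ) : ∃ hy : y ∈ A.domain, A ⟨y, hy⟩ = z := by
  have hd : y ∈ A.adjoint.domain := A.mem_adjoint_domain_of_exists y ⟨z, h⟩
  have hz : A.adjoint ⟨y, hd⟩ = z := LinearPMap.adjoint_apply_eq hA.dense_domain ⟨y, hd⟩ h
  -- The membership proof depends on the operator, so `A.adjoint = A` is used by substituting a
  -- variable.
  have key : ∀ B : H →ₗ.[ℂ] H, B = A → ∀ hB : y ∈ B.domain, B ⟨y, hB⟩ = z →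
      ∃ hy : y ∈ A.domain, A ⟨y, hy⟩ = z := by
    rintro B rfl hB h
    exact ⟨hB, h⟩
  exact key _ (LinearPMap.isSelfAdjoint_def.1 hA) hd hz

/-- Since R* = (A - i)⁻¹, the resolvent identity at ±i makes both RR* and R*R equal to (R* -
R)/(2i). -/
theorem IsResolventI.isStarNormal {A : H →ₗ.[ℂ] H} (hA : IsSelfAdjoint A) {R : H →L[ℂ] H}
    (hR : IsResolventI A R) : IsStarNormal R := by
  have h1 : ∀ y, R (star R y) = (2 * Complex.I)⁻¹ • (star R y - R y) := by
    intro y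
    obtain ⟨hd, hy⟩ := exists_apply_eq_of_isSelfAdjoint hA (y := star R y)
      (z := y + Complex.I • star R y) (fun x => by
        have := ContinuousLinearMap.adjoint_inner_left R (A x + Complex.I • (x : H)) y
        rw [hR.2, inner_add_right, inner_smul_right] at this
        rw [inner_add_left, inner_smul_left, ContinuousLinearMap.star_eq_adjoint, ← this,
          Complex.conj_I]
        ring)
    have h := hR.2 ⟨_, hd⟩
    rw [hy] at h
    simp only [map_add, map_smul] at h
    rw [eq_inv_smul_iff₀ (by simp), eq_sub_iff_add_eq, mul_smul, two_smul]
    exact Eq.trans (by abel) h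
  have h2 : ∀ y, star R (R y) = (2 * Complex.I)⁻¹ • (star R y - R y) := by
    intro y
    obtain ⟨hd, hy⟩ := hR.1 y
    -- Here y - 2iRy = (A - i)Ry.
    have key : star R (y - (2 * Complex.I) • R y) = R y := by
      refine ext_inner_right ℂ fun w => ?_
      obtain ⟨hw, hw'⟩ := hR.1 w
      rw [ContinuousLinearMap.star_eq_adjoint, ContinuousLinearMap.adjoint_inner_left]
      have h3 := inner_apply_eq_of_isSelfAdjoint hA ⟨_, hd⟩ ⟨_, hw⟩
      rw [eq_sub_of_add_eq hy, eq_sub_of_add_eq hw'] at h3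
      simp only [inner_sub_left, inner_sub_right, inner_smul_left, inner_smul_right] at h3 ⊢
      simp only [Complex.conj_I, map_mul, map_ofNat] at h3 ⊢
      linear_combination h3
    rw [map_sub, map_smul] at key
    rw [eq_inv_smul_iff₀ (by simp), eq_sub_iff_add_eq, add_comm]
    exact (sub_eq_iff_eq_add.1 key).symm
  refine ⟨ContinuousLinearMap.ext fun y => ?_⟩
  change star R (R y) = R (star R y)
  rw [h1, h2]

/-- The bounded operator `(l - A) (1 + A²)⁻¹`, whose positive part is `lowerCutoff A l`. -/
def cutoff (A : H →ₗ.[ℂ] H) (l : ℝ) : H →L[ℂ] H :=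
  cfc (fun z : ℂ => ((l * ‖z‖ ^ 2 - z.re : ℝ) : ℂ)) (resolventI A)

/-- The function is a polynomial in z and its conjugate, so the quadratic form can be computed
without functional calculus. -/
theorem cutoff_eq {A : H →ₗ.[ℂ] H} (hA : IsSelfAdjoint A) (l : ℝ) :
    cutoff A l = (l : ℂ) • (star (resolventI A) * resolventI A) -
      (2⁻¹ : ℂ) • (resolventI A + star (resolventI A)) := by
  have hn := (isResolventI_resolventI hA).isStarNormal hA
  have h : (fun z : ℂ => ((l * ‖z‖ ^ 2 - z.re : ℝ) : ℂ)) =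
      fun z : ℂ => (l : ℂ) • (star z * z) - (2⁻¹ : ℂ) • (z + star z) := by
    funext z
    have h1 : star z * z = ((‖z‖ ^ 2 : ℝ) : ℂ) := by
      rw [Complex.star_def, mul_comm, Complex.mul_conj, Complex.normSq_eq_norm_sq]
    have h2 : z + star z = ((2 * z.re : ℝ) : ℂ) := Complex.add_conj z
    rw [h1, h2]
    push_cast
    simp only [smul_eq_mul]
    ring
  have hs : cfc (star : ℂ → ℂ) (resolventI A) = star (resolventI A) := cfc_star_id (R := ℂ) _
  rw [cutoff, h, cfc_sub _ _ _ (by fun_prop) (by fun_prop), cfc_smul _ _ _ (by fun_prop),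
    cfc_smul _ _ _ (by fun_prop), cfc_mul _ _ _ (by fun_prop) (by fun_prop),
    cfc_add _ _ _ (by fun_prop) (by fun_prop), hs, cfc_id' ℂ (resolventI A)]

/-- For u = Rx one has x = (A + i)u, so the right side is ⟨(l - A)u, u⟩. -/
theorem re_inner_cutoff {A : H →ₗ.[ℂ] H} (hA : IsSelfAdjoint A) (l : ℝ) (x : H) :
    RCLike.re ⟪cutoff A l x, x⟫_ℂ =
      l * ‖resolventI A x‖ ^ 2 - RCLike.re ⟪resolventI A x, x⟫_ℂ := by
  rw [cutoff_eq hA, sub_apply, smul_apply, smul_apply, add_apply, mul_apply_eq_comp,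
    ContinuousLinearMap.star_eq_adjoint, inner_sub_left, inner_smul_left, inner_smul_left,
    inner_add_left, ContinuousLinearMap.adjoint_inner_left, ContinuousLinearMap.adjoint_inner_left,
    inner_self_eq_norm_sq_to_K, ← inner_conj_symm x]
  have h2 (z : ℂ) : z + (starRingEnd ℂ) z = ((2 * z.re : ℝ) : ℂ) := Complex.add_conj z
  rw [h2]
  simp only [map_inv₀, map_ofNat, Complex.conj_ofReal, map_sub]
  have h3 : (2 : ℂ)⁻¹ * ((2 * (⟪resolventI A x, x⟫_ℂ).re : ℝ) : ℂ)
      = (((⟪resolventI A x, x⟫_ℂ).re : ℝ) : ℂ) := by push_cast; ring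
  rw [h3]
  simp [← Complex.ofReal_pow]

open scoped ComplexOrder in
theorem cutoff_le_lowerCutoff (A : H →ₗ.[ℂ] H) (l : ℝ) : cutoff A l ≤ lowerCutoff A l := by
  refine cfc_mono (fun z _ => ?_) (by fun_prop) (by fun_prop)
  simp only [Complex.real_le_real]
  exact le_max_left _ _

theorem orthogonal_lowerSpectralSpace (A : H →ₗ.[ℂ] H) (l : ℝ) :
    (lowerSpectralSpace A l)ᗮ = (lowerCutoff A l).ker := by
  have hk := (ContinuousLinearMap.nonneg_iff_isPositive _).1 (lowerCutoff_nonneg A l)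
  rw [lowerSpectralSpace, Submodule.orthogonal_closure, ContinuousLinearMap.orthogonal_range,
    hk.isSelfAdjoint.adjoint_eq]

/-- If x is orthogonal to all the spaces, every `lowerCutoff A l` kills x. As it dominates `cutoff A
l`, this gives l‖Rx‖² ≤ Re⟨Rx, x⟩ for every l, so Rx = 0. -/
theorem topologicalClosure_iSup_lowerSpectralSpace {A : H →ₗ.[ℂ] H} (hA : IsSelfAdjoint A) :
    (⨆ l, lowerSpectralSpace A l).topologicalClosure = ⊤ := by
  rw [Submodule.topologicalClosure_eq_top_iff, Submodule.eq_bot_iff]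
  intro x hx
  have hx' : ∀ l, lowerCutoff A l x = 0 := by
    intro l
    have : x ∈ (lowerSpectralSpace A l)ᗮ := Submodule.orthogonal_le (le_iSup _ l) hx
    rwa [orthogonal_lowerSpectralSpace] at this
  have h : ∀ l : ℝ, l * ‖resolventI A x‖ ^ 2 ≤ RCLike.re ⟪resolventI A x, x⟫_ℂ := by
    intro l
    have h1 := ((ContinuousLinearMap.le_def _ _).1 (cutoff_le_lowerCutoff A l)).re_inner_nonneg_left x
    rw [sub_apply, hx', zero_sub, inner_neg_left, map_neg, re_inner_cutoff hA] at h1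
    linarith
  refine (isResolventI_resolventI hA).injective ?_
  by_contra h0
  have hp : 0 < ‖resolventI A x‖ ^ 2 := by positivity
  have := h ((RCLike.re ⟪resolventI A x, x⟫_ℂ + 1) / ‖resolventI A x‖ ^ 2)
  rw [div_mul_cancel₀ _ hp.ne'] at this
  linarith

open Filter Topology in
theorem tendsto_spectralProj_atTop {A : H →ₗ.[ℂ] H} (hA : IsSelfAdjoint A) (f : H) :
    Tendsto (fun l => ‖spectralProj A l f‖ ^ 2) atTop (𝓝 (‖f‖ ^ 2)) := by
  have h := Submodule.starProjection_tendsto_self (lowerSpectralSpace A) (lowerSpectralSpace_mono A) f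
    (topologicalClosure_iSup_lowerSpectralSpace hA).ge
  exact (h.norm).pow 2

-- The Stieltjes function takes right limits of ‖Π_l f‖². Monotonicity alone bounds its left limit
-- by the value at t; left continuity of Π is not needed.
open Filter Topology in
theorem leftLim_stieltjesFunction_le (A : H →ₗ.[ℂ] H) (f : H) (t : ℝ) :
    Function.leftLim (monotone_norm_sq_spectralProj A f).stieltjesFunction t ≤
      ‖spectralProj A t f‖ ^ 2 := by
  have hm := monotone_norm_sq_spectralProj A f
  have h2 : Tendsto hm.stieltjesFunction (𝓝[<] t)
    (𝓝 (Function.leftLim hm.stieltjesFunction t)) := hm.stieltjesFunction.mono.tendsto_leftLim t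
  refine le_of_tendsto h2 ?_
  filter_upwards [self_mem_nhdsWithin] with s hs
  rw [hm.stieltjesFunction_eq]; exact hm.rightLim_le hs

open Filter Topology in
theorem spectralMeasureAt_Ici_ge {A : H →ₗ.[ℂ] H} (hA : IsSelfAdjoint A) (f : H) (t : ℝ) :
    ENNReal.ofReal (‖f‖ ^ 2 - ‖spectralProj A t f‖ ^ 2) ≤ spectralMeasureAt A f (Ici t) := by
  have hm := monotone_norm_sq_spectralProj A f
  have ht := tendsto_spectralProj_atTop hA f
  have h1 : Tendsto hm.stieltjesFunction atTop (𝓝 (‖f‖ ^ 2)) := by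
    -- The right limit at l lies between the values at l and at l + 1.
    refine tendsto_of_tendsto_of_tendsto_of_le_of_le ht
      (ht.comp (tendsto_atTop_add_const_right _ 1 tendsto_id)) (fun l => ?_) (fun l => ?_)
    · rw [hm.stieltjesFunction_eq]; exact hm.le_rightLim le_rfl
    · rw [hm.stieltjesFunction_eq]; exact hm.rightLim_le (by simp)
  rw [spectralMeasureAt, StieltjesFunction.measure_Ici _ h1]
  exact ENNReal.ofReal_le_ofReal (sub_le_sub_left (leftLim_stieltjesFunction_le A f t) _)

-- The limit at -∞ is only known to be nonnegative, which is enough for an upper bound.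
open Filter Topology in
theorem spectralMeasureAt_Iio_le (A : H →ₗ.[ℂ] H) (f : H) (t : ℝ) :
    spectralMeasureAt A f (Iio t) ≤ ENNReal.ofReal (‖spectralProj A t f‖ ^ 2) := by
  have hm := monotone_norm_sq_spectralProj A f
  have hpos : ∀ l, 0 ≤ hm.stieltjesFunction l := fun l => by
    rw [hm.stieltjesFunction_eq]
    exact le_trans (by positivity) (hm.le_rightLim (x := l) le_rfl)
  have h1 := tendsto_atBot_ciInf hm.stieltjesFunction.mono
    ⟨0, by rintro _ ⟨l, rfl⟩; exact hpos l⟩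
  rw [spectralMeasureAt, StieltjesFunction.measure_Iio _ h1]
  exact ENNReal.ofReal_le_ofReal (by
    linarith [le_ciInf hpos, leftLim_stieltjesFunction_le A f t])

/-- Layer cake for max(t, 0), with closed superlevel sets to match the lower bound on `Ici t`; the
negative part uses open ones to match `Iio`. -/
theorem lintegral_le_posForm {A : H →ₗ.[ℂ] H} (hA : IsSelfAdjoint A) (f : H) :
    ∫⁻ t in Ioi (0 : ℝ), ENNReal.ofReal (‖f‖ ^ 2 - ‖spectralProj A t f‖ ^ 2) ≤ posForm A f := by
  have h := lintegral_eq_lintegral_meas_le (spectralMeasureAt A f) (f := fun t => max t 0)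
    (Filter.Eventually.of_forall fun t => le_max_right _ _) (by fun_prop)
  simp only [ENNReal.ofReal_max, ENNReal.ofReal_zero, max_eq_left (zero_le)] at h
  rw [posForm, h]
  refine setLIntegral_mono' measurableSet_Ioi fun t ht => ?_
  refine (spectralMeasureAt_Ici_ge hA f t).trans (measure_mono fun s hs => ?_)
  exact le_max_of_le_left (mem_Ici.1 hs)

theorem negForm_le_lintegral (A : H →ₗ.[ℂ] H) (f : H) :
    negForm A f ≤ ∫⁻ t in Ioi (0 : ℝ), ENNReal.ofReal (‖spectralProj A (-t) f‖ ^ 2) := by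
  have h := lintegral_eq_lintegral_meas_lt (spectralMeasureAt A f) (f := fun t => max (-t) 0)
    (Filter.Eventually.of_forall fun t => le_max_right _ _) (by fun_prop)
  simp only [ENNReal.ofReal_max, ENNReal.ofReal_zero, max_eq_left (zero_le)] at h
  rw [negForm, h]
  refine setLIntegral_mono' measurableSet_Ioi fun t ht => ?_
  refine le_trans (measure_mono fun s hs => ?_) (spectralMeasureAt_Iio_le A f (-t))
  have hs' : t < max (-s) 0 := hs
  have : t < -s := (lt_max_iff.1 hs').resolve_right (not_lt.2 (le_of_lt ht))
  exact lt_neg_of_lt_neg this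

end Resolvent

/-! ### Integrals of the pseudo-inverse as areas. -/

section PseudoInverse

/-- The positive part of F⁻¹(y) is the length of ]0, F⁻¹(y)[, on which F ≤ y by monotonicity. -/
theorem pseudoInv_toENNReal_le (F : ℝ → ℝ≥0∞) (hF : Monotone F) (y : ℝ≥0∞) :
    (pseudoInv F y).toENNReal ≤ (volume.restrict (Ioi (0 : ℝ))) {t | F t ≤ y} := by
  have h : ∀ t : ℝ, (t : EReal) < pseudoInv F y → F t ≤ y := by
    intro t ht
    obtain ⟨_, ⟨x, hx, rfl⟩, hx'⟩ := lt_sSup_iff.1 ht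
    exact (hF (EReal.coe_lt_coe_iff.1 hx').le).trans hx
  refine le_trans ?_ (measure_mono (s := {t : ℝ | (t : EReal) < pseudoInv F y}) h)
  rw [Measure.restrict_apply' measurableSet_Ioi]
  induction pseudoInv F y with
  | bot => simp
  | coe a =>
    simp only [EReal.toENNReal_of_ne_top (EReal.coe_ne_top a), EReal.toReal_coe,
      EReal.coe_lt_coe_iff]
    have : {t : ℝ | t < a} ∩ Ioi 0 = Ioo 0 a := by ext; simp [and_comm]
    rw [this, Real.volume_Ioo, sub_zero]
  | top => simp

theorem le_neg_pseudoInv_toENNReal (F : ℝ → ℝ≥0∞) (hF : Monotone F) (y : ℝ≥0∞) :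
    (volume.restrict (Ioi (0 : ℝ))) {t | y < F (-t)} ≤ (-pseudoInv F y).toENNReal := by
  have h : ∀ t : ℝ, y < F (-t) → (t : EReal) ≤ -pseudoInv F y := by
    intro t ht
    refine EReal.le_neg_of_le_neg (sSup_le ?_)
    rintro _ ⟨x, hx, rfl⟩
    rw [← EReal.coe_neg, EReal.coe_le_coe_iff]
    by_contra! hlt
    exact (ht.trans_le (hF hlt.le)).not_ge hx
  refine le_trans (measure_mono (t := {t : ℝ | (t : EReal) ≤ -pseudoInv F y}) h) ?_
  rw [Measure.restrict_apply' measurableSet_Ioi]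
  induction -pseudoInv F y with
  | bot => simp
  | coe a =>
    simp only [EReal.toENNReal_of_ne_top (EReal.coe_ne_top a), EReal.toReal_coe,
      EReal.coe_le_coe_iff]
    have : {t : ℝ | t ≤ a} ∩ Ioi 0 = Ioc 0 a := by ext; simp [and_comm]
    rw [this, Real.volume_Ioc, sub_zero]
  | top => simp

theorem volume_le_sub (c : ℝ≥0∞) (y : ℝ) :
    (volume.restrict (Ioo 0 y)) {u | c ≤ ENNReal.ofReal u} ≤ ENNReal.ofReal y - c := by
  rw [Measure.restrict_apply' measurableSet_Ioo]
  induction c with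
  | top => simp
  | coe c =>
    rw [← ENNReal.ofReal_coe_nnreal, ← ENNReal.ofReal_sub _ c.coe_nonneg, ← Real.volume_Icc]
    refine measure_mono fun u hu => ⟨?_, hu.2.2.le⟩
    exact (ENNReal.ofReal_le_ofReal_iff hu.2.1.le).1 hu.1

theorem min_le_volume (c : ℝ≥0∞) (y : ℝ) :
    min (ENNReal.ofReal y) c ≤ (volume.restrict (Ioo 0 y)) {u | ENNReal.ofReal u < c} := by
  rw [Measure.restrict_apply' measurableSet_Ioo]
  induction c with
  | top => simp
  | coe c =>
    rw [← ENNReal.ofReal_coe_nnreal, ← ENNReal.ofReal_min, ← sub_zero (min y c), ← Real.volume_Ioo]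
    refine measure_mono fun u hu => ⟨?_, hu.1, (lt_min_iff.1 hu.2).1⟩
    have h : u < c := (lt_min_iff.1 hu.2).2
    exact (ENNReal.ofReal_lt_ofReal_iff (hu.1.trans h)).2 h

theorem lintegral_measure_swap {α β : Type*} [MeasurableSpace α] [MeasurableSpace β]
    (μ : Measure α) (ν : Measure β) [SFinite μ] [SFinite ν] {s : Set (α × β)}
    (hs : MeasurableSet s) :
    ∫⁻ x, ν {y | (x, y) ∈ s} ∂μ = ∫⁻ y, μ {x | (x, y) ∈ s} ∂ν :=
  (Measure.prod_apply hs).symm.trans (Measure.prod_apply_symm hs)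

/-- Both sides are compared with the area of {(u, t) : 0 < u < y, t > 0, F(t) ≤ u}, sliced in one
direction and then in the other. Truncated subtraction plays the role of the positive part. -/
theorem posInvIntegral_le (F : ℝ → ℝ≥0∞) (hF : Monotone F) (y : ℝ) :
    posInvIntegral F y ≤ ∫⁻ t in Ioi (0 : ℝ), (ENNReal.ofReal y - F t) := by
  have hs : MeasurableSet {p : ℝ × ℝ | F p.2 ≤ ENNReal.ofReal p.1} :=
    measurableSet_le (hF.measurable.comp measurable_snd) (by fun_prop)
  calc posInvIntegral F y
      ≤ ∫⁻ u in Ioo 0 y, (volume.restrict (Ioi (0 : ℝ))) {t | F t ≤ ENNReal.ofReal u} :=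
        lintegral_mono fun u => pseudoInv_toENNReal_le F hF _
    _ = ∫⁻ t in Ioi (0 : ℝ), (volume.restrict (Ioo 0 y)) {u | F t ≤ ENNReal.ofReal u} :=
        lintegral_measure_swap _ _ hs
    _ ≤ _ := lintegral_mono fun t => volume_le_sub _ _

theorem le_negInvIntegral (F : ℝ → ℝ≥0∞) (hF : Monotone F) (y : ℝ) :
    ∫⁻ t in Ioi (0 : ℝ), min (ENNReal.ofReal y) (F (-t)) ≤ negInvIntegral F y := by
  have hs : MeasurableSet {p : ℝ × ℝ | ENNReal.ofReal p.1 < F (-p.2)} :=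
    measurableSet_lt (by fun_prop) (hF.measurable.comp (by fun_prop))
  calc ∫⁻ t in Ioi (0 : ℝ), min (ENNReal.ofReal y) (F (-t))
      ≤ ∫⁻ t in Ioi (0 : ℝ), (volume.restrict (Ioo 0 y)) {u | ENNReal.ofReal u < F (-t)} :=
        lintegral_mono fun t => min_le_volume _ _
    _ = ∫⁻ u in Ioo 0 y, (volume.restrict (Ioi (0 : ℝ))) {t | ENNReal.ofReal u < F (-t)} :=
        (lintegral_measure_swap _ _ hs).symm
    _ ≤ _ := lintegral_mono fun u => le_neg_pseudoInv_toENNReal F hF _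

end PseudoInverse

/-! ### Traces, and the energy of a state as an integral of its distribution function. -/

section Trace

variable {H : Type*} [NormedAddCommGroup H] [InnerProductSpace ℂ H]

theorem tsum_ofReal_norm_sq_inner {ι : Type*} (b : HilbertBasis ι ℂ H) (x : H) :
    ∑' i, ENNReal.ofReal (‖⟪b i, x⟫_ℂ‖ ^ 2) = ENNReal.ofReal (‖x‖ ^ 2) := by
  have h := (b.hasSum_inner_mul_inner x x).mapL Complex.reCLM
  have h' : HasSum (fun i => ‖⟪b i, x⟫_ℂ‖ ^ 2) (‖x‖ ^ 2) := by
    convert h using 1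
    · funext i
      rw [← inner_conj_symm x, mul_comm, RCLike.mul_conj]
      simp [← Complex.ofReal_pow]
    · rw [inner_self_eq_norm_sq_to_K]
      simp [← Complex.ofReal_pow]
  rw [← ENNReal.ofReal_tsum_of_nonneg (fun i => by positivity) h'.summable, h'.tsum_eq]

variable [CompleteSpace H]

/-- T and T* have the same Hilbert–Schmidt norm: expand by Parseval and exchange the two sums. This
stands in for cyclicity of the trace. -/
theorem tsum_ofReal_norm_sq_adjoint {ι : Type*} (b : HilbertBasis ι ℂ H)
    (T : H →L[ℂ] H) :
    ∑' i, ENNReal.ofReal (‖T (b i)‖ ^ 2) =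
      ∑' i, ENNReal.ofReal (‖ContinuousLinearMap.adjoint T (b i)‖ ^ 2) := by
  simp_rw [← tsum_ofReal_norm_sq_inner b]
  rw [ENNReal.tsum_comm]
  refine tsum_congr fun i => tsum_congr fun j => ?_
  rw [ContinuousLinearMap.adjoint_inner_right, norm_inner_symm]

open scoped ComplexOrder in
theorem norm_sq_sqrt_apply {ρ : H →L[ℂ] H} (hρ : ρ.IsPositive) (x : H) :
    ‖CFC.sqrt ρ x‖ ^ 2 = RCLike.re ⟪ρ x, x⟫_ℂ := by
  have h0 : 0 ≤ ρ := (ContinuousLinearMap.nonneg_iff_isPositive _).2 hρ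
  have hs := ((ContinuousLinearMap.nonneg_iff_isPositive _).1 (CFC.sqrt_nonneg ρ)).isSelfAdjoint
  conv_rhs => rw [← CFC.sqrt_mul_sqrt_self ρ h0]
  rw [mul_apply_eq_comp, ← inner_self_eq_norm_sq (𝕜 := ℂ),
    ← ContinuousLinearMap.adjoint_inner_left, hs.adjoint_eq]

theorem trace_eq_tsum_sqrt {ρ : H →L[ℂ] H} (hρ : ρ.IsPositive) :
    trace ρ = ∑' i, ENNReal.ofReal (‖CFC.sqrt ρ (basis H i)‖ ^ 2) := by
  simp_rw [norm_sq_sqrt_apply hρ]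
  rfl

theorem spectralProj_adjoint (A : H →ₗ.[ℂ] H) (l : ℝ) :
    ContinuousLinearMap.adjoint (spectralProj A l) = spectralProj A l :=
  (isSelfAdjoint_starProjection (lowerSpectralSpace A l)).adjoint_eq

theorem norm_spectralProj_apply_le (A : H →ₗ.[ℂ] H) (l : ℝ) (f : H) :
    ‖spectralProj A l f‖ ≤ ‖f‖ :=
  (lowerSpectralSpace A l).norm_starProjection_apply_le f

/-- The index set may be uncountable; a finite sum of the c_i leaves only countably many nonzero
terms. It is used with c_i = ‖ρ^{1/2} e_i‖². -/
theorem lintegral_tsum_of_tsum_ne_top {α ι : Type*} [MeasurableSpace α] (μ : Measure α)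
    {f : ι → α → ℝ≥0∞} (hf : ∀ i, AEMeasurable (f i) μ) {c : ι → ℝ≥0∞} (hc : ∑' i, c i ≠ ∞)
    (h : ∀ i, c i = 0 → f i = 0) :
    ∫⁻ a, ∑' i, f i a ∂μ = ∑' i, ∫⁻ a, f i a ∂μ := by
  have hs := Summable.countable_support_ennreal hc
  have : Countable (Function.support c) := hs.to_subtype
  have key : ∀ g : ι → ℝ≥0∞, (∀ i, c i = 0 → g i = 0) →
      ∑' i, g i = ∑' i : Function.support c, g i := fun g hg =>
    (tsum_subtype_eq_of_support_subset fun i hi hi' => hi (hg i hi')).symm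
  rw [key _ fun i hi => by simp [h i hi]]
  simp_rw [fun a => key (fun i => f i a) fun i hi => congrFun (h i hi) a]
  exact lintegral_tsum fun i => hf i

variable {A : H →ₗ.[ℂ] H} {ρ : H →L[ℂ] H}

theorem measurable_norm_sq_spectralProj (A : H →ₗ.[ℂ] H) (f : H) :
    Measurable fun t => ‖spectralProj A t f‖ ^ 2 :=
  (monotone_norm_sq_spectralProj A f).measurable

/-- The distribution function `τ(ρ^{1/2} Π_l ρ^{1/2})` of the energy in the state `ρ`. -/
def energyCount (A : H →ₗ.[ℂ] H) (ρ : H →L[ℂ] H) (l : ℝ) : ℝ≥0∞ :=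
  ∑' i, ENNReal.ofReal (‖spectralProj A l (CFC.sqrt ρ (basis H i))‖ ^ 2)

theorem energyCount_le_trace (hρ : ρ.IsPositive) (l : ℝ) : energyCount A ρ l ≤ trace ρ := by
  rw [trace_eq_tsum_sqrt hρ]
  refine ENNReal.tsum_le_tsum fun i => ENNReal.ofReal_le_ofReal ?_
  gcongr
  exact norm_spectralProj_apply_le A l _

theorem lintegral_le_posEnergy (hA : IsSelfAdjoint A) (hρ : IsState ρ) :
    ∫⁻ t in Ioi (0 : ℝ), (trace ρ - energyCount A ρ t) ≤ posEnergy A ρ := by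
  have hc := hρ.trace_ne_top
  have hτ := trace_eq_tsum_sqrt hρ.isPositive
  rw [hτ] at hc
  refine le_trans ?_ (ENNReal.tsum_le_tsum fun i => lintegral_le_posForm hA _)
  rw [← lintegral_tsum_of_tsum_ne_top _ (fun i => ?_) hc fun i hi => ?_]
  · refine lintegral_mono fun t => tsub_le_iff_right.2 ?_
    rw [hτ, energyCount, ← ENNReal.tsum_add]
    refine ENNReal.tsum_le_tsum fun i => ?_
    rw [← ENNReal.ofReal_add (sub_nonneg.2 ?_) (by positivity), sub_add_cancel]
    gcongr
    exact norm_spectralProj_apply_le A t _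
  · exact (measurable_const.sub (measurable_norm_sq_spectralProj A _)).ennreal_ofReal.aemeasurable
  · funext t
    rw [ENNReal.ofReal_eq_zero] at hi
    simp only [Pi.zero_apply, ENNReal.ofReal_eq_zero]
    linarith [sq_nonneg ‖spectralProj A t (CFC.sqrt ρ (basis H i))‖]

theorem negEnergy_le_lintegral (hρ : IsState ρ) :
    negEnergy A ρ ≤ ∫⁻ t in Ioi (0 : ℝ), energyCount A ρ (-t) := by
  have hc := hρ.trace_ne_top
  have hτ := trace_eq_tsum_sqrt hρ.isPositive
  rw [hτ] at hc
  refine (ENNReal.tsum_le_tsum fun i => negForm_le_lintegral A _).trans ?_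
  rw [← lintegral_tsum_of_tsum_ne_top _ (fun i => ?_) hc fun i hi => ?_]
  · rfl
  · exact ((measurable_norm_sq_spectralProj A _).comp measurable_neg).ennreal_ofReal.aemeasurable
  · funext t
    have h0 : CFC.sqrt ρ (basis H i) = 0 := by
      rw [ENNReal.ofReal_eq_zero] at hi
      simpa using le_antisymm hi (sq_nonneg _)
    simp [h0]

-- Both sides are squared Hilbert–Schmidt norms, of Π_l ρ^{1/2} and of its adjoint.
open scoped ComplexOrder in
theorem energyCount_eq (hρ : ρ.IsPositive) (l : ℝ) :
    energyCount A ρ l = ∑' i, ENNReal.ofReal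
      (RCLike.re ⟪ρ (spectralProj A l (basis H i)), spectralProj A l (basis H i)⟫_ℂ) := by
  have hs := ((ContinuousLinearMap.nonneg_iff_isPositive _).1 (CFC.sqrt_nonneg ρ)).isSelfAdjoint
  have h := tsum_ofReal_norm_sq_adjoint (basis H) (spectralProj A l ∘L CFC.sqrt ρ)
  rw [ContinuousLinearMap.adjoint_comp, hs.adjoint_eq, spectralProj_adjoint] at h
  refine h.trans (tsum_congr fun i => ?_)
  rw [← norm_sq_sqrt_apply hρ]
  rfl

end Trace

/-! ### Confined states and part (1). -/

section Confined

variable {X : Type*} [MeasurableSpace X] {μ : Measure X}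
  {V : Type*} [NormedAddCommGroup V] [InnerProductSpace ℂ V]
  {Ω : Set X} (hΩ : MeasurableSet Ω)

theorem coeFn_indicatorOp (f : Lp V 2 μ) : indicatorOp μ V hΩ f =ᵐ[μ] Ω.indicator f :=
  coeFn_indicatorLp hΩ f

theorem SupportedIn.indicatorOp_apply {f : Lp V 2 μ} (hf : SupportedIn Ω f) :
    indicatorOp μ V hΩ f = f := by
  refine Lp.ext ?_
  filter_upwards [coeFn_indicatorOp hΩ f, hf] with x h1 h2
  rw [h1]
  by_cases h : x ∈ Ω
  · rw [indicator_of_mem h]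
  · rw [indicator_of_notMem h, h2 h]

theorem inner_indicatorOp_left (f g : Lp V 2 μ) :
    ⟪indicatorOp μ V hΩ f, g⟫_ℂ = ⟪f, indicatorOp μ V hΩ g⟫_ℂ := by
  rw [L2.inner_def, L2.inner_def]
  refine integral_congr_ae ?_
  filter_upwards [coeFn_indicatorOp hΩ f, coeFn_indicatorOp hΩ g] with x h1 h2
  rw [h1, h2]
  by_cases h : x ∈ Ω
  · rw [indicator_of_mem h, indicator_of_mem h]
  · rw [indicator_of_notMem h, indicator_of_notMem h, inner_zero_left, inner_zero_right]

theorem indicatorOp_indicatorOp (f : Lp V 2 μ) :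
    indicatorOp μ V hΩ (indicatorOp μ V hΩ f) = indicatorOp μ V hΩ f := by
  refine SupportedIn.indicatorOp_apply hΩ ?_
  filter_upwards [coeFn_indicatorOp hΩ f] with x h1 h2
  rw [h1, indicator_of_notMem h2]

theorem re_inner_indicatorOp (f : Lp V 2 μ) :
    RCLike.re ⟪indicatorOp μ V hΩ f, f⟫_ℂ = ‖indicatorOp μ V hΩ f‖ ^ 2 := by
  rw [← inner_self_eq_norm_sq (𝕜 := ℂ), ← inner_indicatorOp_left, indicatorOp_indicatorOp]

/-- Confinement and symmetry give ρ = χ_Ω ρ χ_Ω, hence ρ ≤ ‖ρ‖ χ_Ω as quadratic forms. -/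
theorem IsConfined.re_inner_le {ρ : Lp V 2 μ →L[ℂ] Lp V 2 μ} (hρ : ρ.IsPositive)
    (hc : IsConfined Ω ρ) (f : Lp V 2 μ) :
    RCLike.re ⟪ρ f, f⟫_ℂ ≤ ‖ρ‖ * ‖indicatorOp μ V hΩ f‖ ^ 2 := by
  have h1 : ∀ g, indicatorOp μ V hΩ (ρ g) = ρ g := fun g => (hc g).indicatorOp_apply hΩ
  have hs : ∀ g h, ⟪ρ g, h⟫_ℂ = ⟪g, ρ h⟫_ℂ := hρ.isSymmetric
  have h2 : ⟪ρ f, f⟫_ℂ = ⟪ρ (indicatorOp μ V hΩ f), indicatorOp μ V hΩ f⟫_ℂ := by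
    rw [← inner_indicatorOp_left hΩ (ρ _), h1, hs, hs,
      inner_indicatorOp_left, h1]
  rw [h2, sq, ← mul_assoc]
  exact (re_inner_le_norm _ _).trans (mul_le_mul_of_nonneg_right (ρ.le_opNorm _) (norm_nonneg _))

variable [CompleteSpace V]

theorem spectralCount_eq (A : Lp V 2 μ →ₗ.[ℂ] Lp V 2 μ) (l : ℝ) :
    spectralCount A hΩ l = ∑' i, ENNReal.ofReal
      (‖indicatorOp μ V hΩ (spectralProj A l (basis (Lp V 2 μ) i))‖ ^ 2) := by
  refine tsum_congr fun i => ?_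
  rw [← re_inner_indicatorOp]
  rw [← ContinuousLinearMap.adjoint_inner_left (spectralProj A l), spectralProj_adjoint]
  rfl

theorem energyCount_le (A : Lp V 2 μ →ₗ.[ℂ] Lp V 2 μ) {ρ : Lp V 2 μ →L[ℂ] Lp V 2 μ}
    (hρ : ρ.IsPositive) (hc : IsConfined Ω ρ) (l : ℝ) :
    energyCount A ρ l ≤ ENNReal.ofReal ‖ρ‖ * spectralCount A hΩ l := by
  rw [energyCount_eq hρ, spectralCount_eq, ← ENNReal.tsum_mul_left]
  refine ENNReal.tsum_le_tsum fun i => ?_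
  rw [← ENNReal.ofReal_mul (norm_nonneg _)]
  exact ENNReal.ofReal_le_ofReal (hc.re_inner_le hΩ hρ _)

/-- Passing from χ_Ω Π_l to its adjoint Π_l χ_Ω makes each term of the sum monotone in l. -/
theorem monotone_spectralCount (A : Lp V 2 μ →ₗ.[ℂ] Lp V 2 μ) :
    Monotone (spectralCount A hΩ) := by
  intro l m hlm
  have key : ∀ k, spectralCount A hΩ k = ∑' i, ENNReal.ofReal
      (‖spectralProj A k (indicatorOp μ V hΩ (basis (Lp V 2 μ) i))‖ ^ 2) := by
    intro k
    have hi : ContinuousLinearMap.adjoint (indicatorOp μ V hΩ) = indicatorOp μ V hΩ :=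
      ((ContinuousLinearMap.eq_adjoint_iff _ _).2 (inner_indicatorOp_left hΩ)).symm
    have h := tsum_ofReal_norm_sq_adjoint (basis (Lp V 2 μ))
      (spectralProj A k ∘L indicatorOp μ V hΩ)
    rw [ContinuousLinearMap.adjoint_comp, hi, spectralProj_adjoint] at h
    rw [spectralCount_eq]
    exact h.symm
  rw [key, key]
  exact ENNReal.tsum_le_tsum fun i =>
    ENNReal.ofReal_le_ofReal (monotone_norm_sq_spectralProj A _ hlm)

variable {A : Lp V 2 μ →ₗ.[ℂ] Lp V 2 μ} {ρ : Lp V 2 μ →L[ℂ] Lp V 2 μ}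

theorem trace_eq_norm_mul (hρ : IsState ρ) (h0 : ρ ≠ 0) :
    trace ρ = ENNReal.ofReal ‖ρ‖ * ENNReal.ofReal ((trace ρ).toReal / ‖ρ‖) := by
  rw [← ENNReal.ofReal_mul (norm_nonneg _), mul_div_cancel₀ _ (norm_ne_zero_iff.2 h0),
    ENNReal.ofReal_toReal hρ.trace_ne_top]

theorem norm_mul_posInvIntegral_le (hA : IsSelfAdjoint A) (hρ : IsState ρ) (h0 : ρ ≠ 0)
    (hc : IsConfined Ω ρ) :
    ENNReal.ofReal ‖ρ‖ * posInvIntegral (spectralCount A hΩ) ((trace ρ).toReal / ‖ρ‖) ≤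
      posEnergy A ρ := by
  refine le_trans ?_ (lintegral_le_posEnergy hA hρ)
  refine (mul_le_mul_right (posInvIntegral_le _ (monotone_spectralCount hΩ A) _) _).trans ?_
  rw [← lintegral_const_mul' _ _ ENNReal.ofReal_ne_top]
  refine lintegral_mono fun t => ?_
  rw [ENNReal.mul_sub (fun _ _ => ENNReal.ofReal_ne_top), ← trace_eq_norm_mul hρ h0]
  exact tsub_le_tsub_left (energyCount_le hΩ A hρ.isPositive hc t) _

theorem negEnergy_le_norm_mul (hρ : IsState ρ) (h0 : ρ ≠ 0) (hc : IsConfined Ω ρ) :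
    negEnergy A ρ ≤
      ENNReal.ofReal ‖ρ‖ * negInvIntegral (spectralCount A hΩ) ((trace ρ).toReal / ‖ρ‖) := by
  refine (negEnergy_le_lintegral hρ).trans (le_trans ?_
    (mul_le_mul_right (le_negInvIntegral _ (monotone_spectralCount hΩ A) _) _))
  rw [← lintegral_const_mul' _ _ ENNReal.ofReal_ne_top]
  refine lintegral_mono fun t => ?_
  rw [mul_min, ← trace_eq_norm_mul hρ h0]
  exact le_min (energyCount_le_trace hρ.isPositive _) (energyCount_le hΩ A hρ.isPositive hc _)

/-- Finiteness of P forces that of p, so ∞ - ∞ never occurs; if q = ∞ the left side is ⊥. -/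
theorem coe_mul_sub_le_sub {m : ℝ} (hm : 0 < m) {p q P Q : ℝ≥0∞} (hP : P ≠ ∞)
    (h1 : ENNReal.ofReal m * p ≤ P) (h2 : Q ≤ ENNReal.ofReal m * q) :
    (m : EReal) * ((p : EReal) - (q : EReal)) ≤ (P : EReal) - (Q : EReal) := by
  have hm' : ENNReal.ofReal m ≠ 0 := by simpa using hm
  have hp : p ≠ ∞ := fun h => by
    rw [h, ENNReal.mul_top hm'] at h1
    exact hP (top_le_iff.1 h1)
  rcases eq_or_ne q ∞ with rfl | hq
  · have : ((p : EReal) - ((⊤ : ℝ≥0∞) : EReal)) = ⊥ := by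
      lift p to NNReal using hp
      rfl
    rw [this, EReal.coe_mul_bot_of_pos hm]
    exact bot_le
  have hQ : Q ≠ ∞ := ne_top_of_le_ne_top (ENNReal.mul_ne_top ENNReal.ofReal_ne_top hq) h2
  lift p to NNReal using hp
  lift q to NNReal using hq
  lift P to NNReal using hP
  lift Q to NNReal using hQ
  lift m to NNReal using hm.le
  rw [ENNReal.ofReal_coe_nnreal] at h1 h2
  norm_cast at h1 h2
  have h1' : (m : ℝ) * p ≤ P := by exact_mod_cast h1
  have h2' : (Q : ℝ) ≤ m * q := by exact_mod_cast h2
  change ((m : ℝ) : EReal) * (((p : ℝ) : EReal) - ((q : ℝ) : EReal)) ≤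
    ((P : ℝ) : EReal) - ((Q : ℝ) : EReal)
  norm_cast
  linarith

theorem norm_mul_invIntegral_le_energy (hA : IsSelfAdjoint A) (hρ : IsState ρ) (h0 : ρ ≠ 0)
    (hc : IsConfined Ω ρ) (hE : posEnergy A ρ ≠ ∞) :
    posInvIntegral (spectralCount A hΩ) ((trace ρ).toReal / ‖ρ‖) ≠ ∞ ∧
      (‖ρ‖ : EReal) * invIntegral (spectralCount A hΩ) ((trace ρ).toReal / ‖ρ‖) ≤ energy A ρ := by
  have hm : 0 < ‖ρ‖ := norm_pos_iff.2 h0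
  have h1 := norm_mul_posInvIntegral_le hΩ hA hρ h0 hc
  refine ⟨fun h => ?_, coe_mul_sub_le_sub hm hE h1 (negEnergy_le_norm_mul hΩ hρ h0 hc)⟩
  rw [h, ENNReal.mul_top (by simpa only [ne_eq, ENNReal.ofReal_eq_zero, not_le] using hm)] at h1
  exact hE (top_le_iff.1 h1)

end Confined

/-! ### A self-adjointness criterion, and reducing operators. -/

section Reducing

variable {H : Type*} [NormedAddCommGroup H] [InnerProductSpace ℂ H]

theorem IsResolventI.commute {A : H →ₗ.[ℂ] H} {R Q : H →L[ℂ] H} (hR : IsResolventI A R)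
    (hQ : ∀ x : A.domain, ∃ h : Q x ∈ A.domain, A ⟨Q x, h⟩ = Q (A x)) : Commute R Q := by
  refine ContinuousLinearMap.ext fun y => ?_
  obtain ⟨hy, hy'⟩ := hR.1 y
  obtain ⟨hq, hq'⟩ := hQ ⟨R y, hy⟩
  have h := hR.2 ⟨_, hq⟩
  rw [hq'] at h
  have h1 : Q (A ⟨R y, hy⟩) + Complex.I • Q (R y) = Q y := by
    rw [← map_smul, ← map_add, hy']
  exact (congrArg R h1).symm.trans h

variable [CompleteSpace H]

/-- If y = (A + 1)x is orthogonal to the domain, then ⟨Ax, x⟩ + ‖x‖² = 0 and x = 0, so the domain is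
dense. If y is in the domain of A*, solve (A + 1)x = (A* + 1)y; then y - x is orthogonal to the
range of A + 1, so y = x. -/
theorem isSelfAdjoint_of_surjective {A : H →ₗ.[ℂ] H}
    (hs : ∀ x y : A.domain, ⟪A x, (y : H)⟫_ℂ = ⟪(x : H), A y⟫_ℂ)
    (hp : ∀ x : A.domain, 0 ≤ RCLike.re ⟪A x, (x : H)⟫_ℂ)
    (h : ∀ y : H, ∃ x : A.domain, A x + x = y) : IsSelfAdjoint A := by
  have hd : Dense (A.domain : Set H) := by
    rw [Submodule.dense_iff_topologicalClosure_eq_top, Submodule.topologicalClosure_eq_top_iff,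
      Submodule.eq_bot_iff]
    intro y hy
    obtain ⟨x, rfl⟩ := h y
    have h1 : ⟪A x + x, (x : H)⟫_ℂ = 0 := Submodule.inner_left_of_mem_orthogonal x.2 hy
    have h2 := congrArg RCLike.re h1
    rw [inner_add_left, map_add, inner_self_eq_norm_sq, map_zero] at h2
    have h3 : (x : H) = 0 := by
      have : ‖(x : H)‖ ^ 2 = 0 := by linarith [hp x, sq_nonneg ‖(x : H)‖]
      simpa using this
    have h4 : x = 0 := Subtype.ext h3
    rw [h4, LinearPMap.map_zero]
    simp
  rw [LinearPMap.isSelfAdjoint_def]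
  have hle : A ≤ A.adjoint := LinearPMap.IsFormalAdjoint.le_adjoint hd hs
  refine (LinearPMap.eq_of_le_of_domain_eq hle (le_antisymm hle.1 fun y hy => ?_)).symm
  obtain ⟨x, hx⟩ := h (A.adjoint ⟨y, hy⟩ + y)
  have hyx : y - x = 0 := by
    obtain ⟨z, hz⟩ := h (y - x)
    have h1 : ⟪A.adjoint ⟨y, hy⟩, (z : H)⟫_ℂ = ⟪y, A z⟫_ℂ :=
      LinearPMap.adjoint_isFormalAdjoint hd ⟨y, hy⟩ z
    have h2 : ⟪y - x, y - x⟫_ℂ = 0 := by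
      have h3 := congrArg (fun w => ⟪w, (z : H)⟫_ℂ) hx
      simp only [inner_add_left, h1, hs] at h3
      nth_rewrite 2 [← hz]
      rw [inner_add_right, inner_sub_left, inner_sub_left]
      linear_combination -h3
    exact inner_self_eq_zero.1 h2
  rw [sub_eq_zero.1 hyx]
  exact x.2

theorem apply_eq_zero_of_re_inner_eq_zero {T : H →L[ℂ] H} (hT : T.IsPositive) {x : H}
    (h : RCLike.re ⟪T x, x⟫_ℂ = 0) : T x = 0 := by
  rw [← norm_sq_sqrt_apply hT] at h
  have h' : CFC.sqrt T x = 0 := by simpa using h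
  rw [← CFC.sqrt_mul_sqrt_self T ((ContinuousLinearMap.nonneg_iff_isPositive _).2 hT),
    mul_apply_eq_comp, h', map_zero]

/-- Write C for `cutoff A l` and C⁺ for `lowerCutoff A l`. Since Q commutes with R and R*, it fixes
y = C⁺x and Ry. Then CC⁺ = (C⁺)² gives ⟨C⁺y, y⟩ = ⟨Cy, y⟩ = ⟨(l - A)Ry, Ry⟩ ≤ 0, so C⁺y = 0 and ‖y‖²
= ⟨x, C⁺y⟩ = 0. -/
theorem lowerCutoff_apply_eq_zero {A : H →ₗ.[ℂ] H} (hA : IsSelfAdjoint A) {Q : H →L[ℂ] H}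
    (hQs : IsSelfAdjoint Q)
    (hQ : ∀ x : A.domain, ∃ h : Q x ∈ A.domain, A ⟨Q x, h⟩ = Q (A x)) {l : ℝ}
    (hl : ∀ x : A.domain, Q x = x → l * ‖(x : H)‖ ^ 2 ≤ RCLike.re ⟪A x, (x : H)⟫_ℂ) {x : H}
    (hx : Q x = x) : lowerCutoff A l x = 0 := by
  have hR := isResolventI_resolventI hA
  have hn := hR.isStarNormal hA
  have hc : Commute (resolventI A) Q := hR.commute hQ
  have hc' : Commute (star (resolventI A)) Q := by
    have := hc.star_star
    rwa [hQs.star_eq] at this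
  have hcut : Commute (lowerCutoff A l) Q := hc.cfc hc' _
  have hpos := (ContinuousLinearMap.nonneg_iff_isPositive _).1 (lowerCutoff_nonneg A l)
  set y := lowerCutoff A l x with hy
  have hQy : Q y = y := by
    have : lowerCutoff A l (Q x) = Q (lowerCutoff A l x) :=
      congrArg (fun T : H →L[ℂ] H => T x) hcut
    rw [hy, ← this, hx]
  have hmul : cutoff A l * lowerCutoff A l = lowerCutoff A l * lowerCutoff A l := by
    rw [cutoff, lowerCutoff, ← cfc_mul _ _ _ (by fun_prop) (by fun_prop),
      ← cfc_mul _ _ _ (by fun_prop) (by fun_prop)]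
    congr 1
    funext z
    rw [← Complex.ofReal_mul, ← Complex.ofReal_mul]
    rcases le_total (l * ‖z‖ ^ 2 - z.re) 0 with h | h
    · rw [max_eq_right h, mul_zero, mul_zero]
    · rw [max_eq_left h]
  have h1 : cutoff A l y = lowerCutoff A l y := congrArg (fun T : H →L[ℂ] H => T x) hmul
  have h2 : RCLike.re ⟪cutoff A l y, y⟫_ℂ ≤ 0 := by
    obtain ⟨hd, hd'⟩ := hR.1 y
    have hQu : Q (resolventI A y) = resolventI A y := by
      have : resolventI A (Q y) = Q (resolventI A y) := congrArg (fun T : H →L[ℂ] H => T y) hc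
      rw [← this, hQy]
    have h3 := hl ⟨_, hd⟩ hQu
    rw [eq_sub_of_add_eq hd', inner_sub_left, inner_smul_left, map_sub, inner_re_symm,
      inner_self_eq_norm_sq_to_K] at h3
    simp only [Complex.conj_I] at h3
    rw [re_inner_cutoff hA]
    have h4 : RCLike.re (-Complex.I * ((‖resolventI A y‖ : ℝ) : ℂ) ^ 2) = 0 := by
      simp [← Complex.ofReal_pow]
    have h5 : l * ‖resolventI A y‖ ^ 2 ≤ RCLike.re ⟪resolventI A y, y⟫_ℂ -
      RCLike.re (-Complex.I * ((‖resolventI A y‖ : ℝ) : ℂ) ^ 2) := h3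
    linarith
  rw [h1] at h2
  have h3 : lowerCutoff A l y = 0 :=
    apply_eq_zero_of_re_inner_eq_zero hpos (le_antisymm h2 (hpos.re_inner_nonneg_left y))
  have h4 : ⟪lowerCutoff A l x, y⟫_ℂ = ⟪x, lowerCutoff A l y⟫_ℂ := hpos.isSymmetric x y
  rw [h3, inner_zero_right] at h4
  exact inner_self_eq_zero.1 h4

theorem norm_spectralProj_le_norm_sub {A : H →ₗ.[ℂ] H} {l : ℝ} {f g : H}
    (hg : lowerCutoff A l g = 0) : ‖spectralProj A l f‖ ≤ ‖f - g‖ := by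
  have h : g ∈ (lowerSpectralSpace A l)ᗮ := by
    rw [orthogonal_lowerSpectralSpace]
    exact hg
  have h0 : spectralProj A l g = 0 :=
    (Submodule.starProjection_apply_eq_zero_iff (lowerSpectralSpace A l)).2 h
  have : spectralProj A l f = spectralProj A l (f - g) := by rw [map_sub, h0, sub_zero]
  rw [this]
  exact norm_spectralProj_apply_le A l _

end Reducing

/-! ### The Laplacian on the Fourier side. -/

section Fourier

open scoped Laplacian SchwartzMap FourierTransform ContDiff

variable {n : ℕ}

local notation "L2(" n ")" => Lp ℂ 2 (volume : Measure (EuclideanSpace ℝ (Fin n)))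

/-- The symbol `4π²‖ξ‖²` of the Laplacian. -/
def laplacianSymbol (ξ : EuclideanSpace ℝ (Fin n)) : ℝ := (2 * Real.pi) ^ 2 * ‖ξ‖ ^ 2

theorem laplacianSymbol_nonneg (ξ : EuclideanSpace ℝ (Fin n)) : 0 ≤ laplacianSymbol ξ := by
  rw [laplacianSymbol]; positivity

theorem continuous_laplacianSymbol :
    Continuous (laplacianSymbol : EuclideanSpace ℝ (Fin n) → ℝ) := by
  unfold laplacianSymbol; fun_prop

theorem fourier_neg_laplacian_apply (f : L2(n)) (u : 𝓢(EuclideanSpace ℝ (Fin n), ℂ)) :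
    𝓕 (-Δ (Lp.toTemperedDistribution f)) u =
      ∫ ξ, u ξ • ((laplacianSymbol ξ : ℂ) * (𝓕 f : L2(n)) ξ) := by
  have hg : (fun x : EuclideanSpace ℝ (Fin n) => Complex.ofReal (‖x‖ ^ 2)).HasTemperateGrowth := by
    fun_prop
  rw [TemperedDistribution.laplacian_eq_fourierMultiplierCLM, neg_smul, neg_neg,
    ← Complex.coe_smul, FourierTransform.fourier_smul, TemperedDistribution.fourierMultiplierCLM_apply,
    FourierTransform.fourier_fourierInv_eq, Lp.fourier_toTemperedDistribution_eq]
  change ((((2 * Real.pi) ^ 2 : ℝ) : ℂ) • (Lp.toTemperedDistribution (𝓕 f : L2(n)))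
    (SchwartzMap.smulLeftCLM ℂ _ u)) = _
  rw [Lp.toTemperedDistribution_apply, ← integral_smul]
  refine integral_congr_ae (Filter.Eventually.of_forall fun ξ => ?_)
  simp only [SchwartzMap.smulLeftCLM_apply_apply hg, laplacianSymbol, smul_eq_mul]
  push_cast
  ring

/-- The symbol times the transform of f is a priori only locally integrable, so the two sides are
compared by testing against smooth compactly supported functions. -/
theorem mem_laplacianGraph_iff {f g : L2(n)} :
    (f, g) ∈ laplacianGraph n ↔
      ∀ᵐ ξ, (𝓕 g : L2(n)) ξ = (laplacianSymbol ξ : ℂ) * (𝓕 f : L2(n)) ξ := by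
  have h1 : (f, g) ∈ laplacianGraph n ↔
      𝓕 (-Δ (Lp.toTemperedDistribution f)) = Lp.toTemperedDistribution (𝓕 g : L2(n)) := by
    rw [← Lp.fourier_toTemperedDistribution_eq]
    refine ⟨fun h => congrArg _ h, fun h => ?_⟩
    have := congrArg (FourierTransform.fourierInv) h
    rwa [FourierTransform.fourierInv_fourier_eq, FourierTransform.fourierInv_fourier_eq] at this
  rw [h1]
  constructor
  · intro h
    refine ae_eq_of_integral_contDiff_smul_eq ((Lp.memLp _).locallyIntegrable (by norm_num)) ?_ ?_
    · refine (locallyIntegrable_iff).2 fun K hK => ?_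
      exact (((Lp.memLp _).locallyIntegrable (by norm_num)).integrableOn_isCompact
        hK).continuousOn_mul
        (Complex.continuous_ofReal.comp continuous_laplacianSymbol).continuousOn hK
    intro φ hφ hc
    have hg₁ : HasCompactSupport (Complex.ofRealCLM ∘ φ) := hc.comp_left rfl
    have hg₂ : ContDiff ℝ ∞ (Complex.ofRealCLM ∘ φ) := by fun_prop
    have := congrArg (fun T => T (hg₁.toSchwartzMap hg₂)) h
    simp only [fourier_neg_laplacian_apply, Lp.toTemperedDistribution_apply] at this
    simpa using this.symm
  · intro h
    ext u
    rw [fourier_neg_laplacian_apply, Lp.toTemperedDistribution_apply]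
    refine integral_congr_ae ?_
    filter_upwards [h] with ξ hξ
    rw [hξ]

/-- Surjectivity of Δ + 1: divide the transform by 1 + 4π²‖ξ‖². -/
theorem exists_add_mem_laplacianGraph (h : L2(n)) : ∃ u : L2(n), (u, h - u) ∈ laplacianGraph n := by
  have hpos : ∀ ξ : EuclideanSpace ℝ (Fin n), 0 < 1 + laplacianSymbol ξ := fun ξ => by
    linarith [laplacianSymbol_nonneg ξ]
  have hm : MemLp (fun ξ => (((1 + laplacianSymbol ξ)⁻¹ : ℝ) : ℂ) * (𝓕 h : L2(n)) ξ) 2 volume := by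
    refine (Lp.memLp (𝓕 h : L2(n))).mono ?_ (Filter.Eventually.of_forall fun ξ => ?_)
    · refine AEStronglyMeasurable.mul ?_ (Lp.aestronglyMeasurable _)
      refine (Complex.continuous_ofReal.comp ?_).aestronglyMeasurable
      exact (continuous_const.add continuous_laplacianSymbol).inv₀ fun ξ => (hpos ξ).ne'
    · rw [norm_mul, Complex.norm_real, Real.norm_of_nonneg (inv_nonneg.2 (hpos ξ).le)]
      exact mul_le_of_le_one_left (norm_nonneg _)
        (inv_le_one_of_one_le₀ (by linarith [laplacianSymbol_nonneg ξ]))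
  refine ⟨𝓕⁻ hm.toLp, mem_laplacianGraph_iff.2 ?_⟩
  have h1 : (𝓕 (h - 𝓕⁻ hm.toLp) : L2(n)) = 𝓕 h - hm.toLp := by
    rw [sub_eq_add_neg, FourierTransform.fourier_add, FourierTransform.fourier_neg,
      FourierTransform.fourier_fourierInv_eq, sub_eq_add_neg]
  rw [h1, FourierTransform.fourier_fourierInv_eq]
  filter_upwards [Lp.coeFn_sub (𝓕 h : L2(n)) hm.toLp, hm.coeFn_toLp] with ξ h2 h3
  rw [h2, Pi.sub_apply, h3]
  have : (1 + laplacianSymbol ξ : ℂ) ≠ 0 := by exact_mod_cast (hpos ξ).ne'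
  push_cast
  field_simp
  ring

theorem laplacian_apply_mem (x : (laplacian n).domain) :
    ((x : L2(n)), laplacian n x) ∈ laplacianGraph n :=
  Submodule.mem_graph_toLinearPMap (fun p hp h => laplacianGraph_isGraph n p hp h) x

theorem exists_laplacian_apply_eq {f g : L2(n)} (h : (f, g) ∈ laplacianGraph n) :
    ∃ hf : f ∈ (laplacian n).domain, laplacian n ⟨f, hf⟩ = g := by
  have h' : (f, g) ∈ (laplacian n).graph := by
    rw [laplacian, Submodule.toLinearPMap_graph_eq _ fun p hp h => laplacianGraph_isGraph n p hp h]
    exact h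
  obtain ⟨x, hx, hx'⟩ := (LinearPMap.mem_graph_iff _).1 h'
  simp only at hx hx'
  subst hx
  exact ⟨x.2, hx'⟩

theorem inner_eq_of_mem_laplacianGraph {f g f' g' : L2(n)} (h : (f, g) ∈ laplacianGraph n)
    (h' : (f', g') ∈ laplacianGraph n) : ⟪g, f'⟫_ℂ = ⟪f, g'⟫_ℂ := by
  rw [← Lp.inner_fourier_eq g, ← Lp.inner_fourier_eq f, L2.inner_def, L2.inner_def]
  refine integral_congr_ae ?_
  filter_upwards [mem_laplacianGraph_iff.1 h, mem_laplacianGraph_iff.1 h'] with ξ h1 h2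
  rw [h1, h2, RCLike.inner_apply, RCLike.inner_apply, map_mul, Complex.conj_ofReal]
  ring

theorem le_re_inner_of_mem_laplacianGraph {f g : L2(n)} (h : (f, g) ∈ laplacianGraph n) {l : ℝ}
    (hl : ∀ᵐ ξ, laplacianSymbol ξ < l → (𝓕 f : L2(n)) ξ = 0) :
    l * ‖f‖ ^ 2 ≤ RCLike.re ⟪g, f⟫_ℂ := by
  have key : 0 ≤ RCLike.re ⟪g - (l : ℂ) • f, f⟫_ℂ := by
    rw [← Lp.inner_fourier_eq, L2.inner_def, ← integral_re (L2.integrable_inner _ _)]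
    refine integral_nonneg_of_ae ?_
    have h1 : (𝓕 (g - (l : ℂ) • f) : L2(n)) = 𝓕 g - (l : ℂ) • 𝓕 f := by
      rw [sub_eq_add_neg, FourierTransform.fourier_add, FourierTransform.fourier_neg,
        FourierTransform.fourier_smul, sub_eq_add_neg]
    rw [h1]
    filter_upwards [mem_laplacianGraph_iff.1 h, hl, Lp.coeFn_smul (l : ℂ) (𝓕 f : L2(n)),
      Lp.coeFn_sub (𝓕 g : L2(n)) ((l : ℂ) • 𝓕 f)] with ξ h2 h3 h4 h5
    rw [h5, Pi.sub_apply, h4, Pi.smul_apply, h2, smul_eq_mul, ← sub_mul, ← Complex.ofReal_sub]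
    rcases lt_or_ge (laplacianSymbol ξ) l with h6 | h6
    · simp [h3 h6]
    · have : ⟪((laplacianSymbol ξ - l : ℝ) : ℂ) * (𝓕 f : L2(n)) ξ, (𝓕 f : L2(n)) ξ⟫_ℂ =
          (((laplacianSymbol ξ - l) * ‖(𝓕 f : L2(n)) ξ‖ ^ 2 : ℝ) : ℂ) := by
        rw [← smul_eq_mul, inner_smul_left, Complex.conj_ofReal, inner_self_eq_norm_sq_to_K]
        push_cast
        rfl
      rw [this]
      exact mul_nonneg (sub_nonneg.2 h6) (sq_nonneg _)
  rw [inner_sub_left, inner_smul_left, Complex.conj_ofReal, inner_self_eq_norm_sq_to_K,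
    map_sub] at key
  have h1 : RCLike.re ((l : ℂ) * ((‖f‖ : ℝ) : ℂ) ^ 2) = l * ‖f‖ ^ 2 := by
    simp [← Complex.ofReal_pow]
  have h2 : 0 ≤ RCLike.re ⟪g, f⟫_ℂ - RCLike.re ((l : ℂ) * ((‖f‖ : ℝ) : ℂ) ^ 2) := key
  linarith

theorem isSelfAdjoint_laplacian (n : ℕ) : IsSelfAdjoint (laplacian n) := by
  refine isSelfAdjoint_of_surjective
    (fun x y => inner_eq_of_mem_laplacianGraph (laplacian_apply_mem x) (laplacian_apply_mem y))
    (fun x => ?_) (fun y => ?_)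
  · have := le_re_inner_of_mem_laplacianGraph (laplacian_apply_mem x) (l := 0)
      (Filter.Eventually.of_forall fun ξ h => absurd h (laplacianSymbol_nonneg ξ).not_gt)
    simpa using this
  · obtain ⟨u, hu⟩ := exists_add_mem_laplacianGraph y
    obtain ⟨h, h'⟩ := exists_laplacian_apply_eq hu
    exact ⟨⟨u, h⟩, by rw [h', sub_add_cancel]⟩

theorem measurableSet_le_laplacianSymbol (l : ℝ) :
    MeasurableSet {ξ : EuclideanSpace ℝ (Fin n) | l ≤ laplacianSymbol ξ} :=
  measurableSet_le measurable_const continuous_laplacianSymbol.measurable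

variable (n) in
/-- The orthogonal projection on the functions whose Fourier transform is supported in
`{4π²‖ξ‖² ≥ l}`. -/
def highPass (l : ℝ) : L2(n) →L[ℂ] L2(n) :=
  ((Lp.fourierTransformₗᵢ (EuclideanSpace ℝ (Fin n)) ℂ).symm.toLinearIsometry.toContinuousLinearMap)
    ∘L indicatorOp volume ℂ (measurableSet_le_laplacianSymbol l) ∘L
    ((Lp.fourierTransformₗᵢ (EuclideanSpace ℝ (Fin n)) ℂ).toLinearIsometry.toContinuousLinearMap)

theorem fourier_highPass (l : ℝ) (f : L2(n)) :
    𝓕 (highPass n l f) = indicatorOp volume ℂ (measurableSet_le_laplacianSymbol l) (𝓕 f) :=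
  (Lp.fourierTransformₗᵢ (EuclideanSpace ℝ (Fin n)) ℂ).apply_symm_apply _

theorem isSelfAdjoint_highPass (l : ℝ) : IsSelfAdjoint (highPass n l) := by
  refine ContinuousLinearMap.isSelfAdjoint_iff_isSymmetric.2 fun f g => ?_
  change ⟪highPass n l f, g⟫_ℂ = ⟪f, highPass n l g⟫_ℂ
  rw [← Lp.inner_fourier_eq, ← Lp.inner_fourier_eq f, fourier_highPass, fourier_highPass,
    inner_indicatorOp_left]

theorem highPass_highPass (l : ℝ) (f : L2(n)) : highPass n l (highPass n l f) = highPass n l f := by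
  refine (Lp.fourierTransformₗᵢ (EuclideanSpace ℝ (Fin n)) ℂ).injective ?_
  change 𝓕 (highPass n l (highPass n l f)) = 𝓕 (highPass n l f)
  rw [fourier_highPass, fourier_highPass, indicatorOp_indicatorOp]

/-- The high-pass projection and Δ are multiplications on the Fourier side, so they commute, and Δ ≥
l on its range. -/
theorem lowerCutoff_laplacian_highPass (l : ℝ) (f : L2(n)) :
    lowerCutoff (laplacian n) l (highPass n l f) = 0 := by
  refine lowerCutoff_apply_eq_zero (isSelfAdjoint_laplacian n) (isSelfAdjoint_highPass l)
    (fun x => exists_laplacian_apply_eq (mem_laplacianGraph_iff.2 ?_)) (fun x hx => ?_)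
    (highPass_highPass l f)
  · rw [fourier_highPass, fourier_highPass]
    filter_upwards [mem_laplacianGraph_iff.1 (laplacian_apply_mem x),
      coeFn_indicatorOp (measurableSet_le_laplacianSymbol l) (𝓕 (x : L2(n))),
      coeFn_indicatorOp (measurableSet_le_laplacianSymbol l) (𝓕 (laplacian n x))] with ξ h1 h2 h3
    rw [h2, h3]
    by_cases h : ξ ∈ {ξ : EuclideanSpace ℝ (Fin n) | l ≤ laplacianSymbol ξ}
    · rw [indicator_of_mem h, indicator_of_mem h, h1]
    · rw [indicator_of_notMem h, indicator_of_notMem h, mul_zero]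
  · refine le_re_inner_of_mem_laplacianGraph (laplacian_apply_mem x) ?_
    have h := fourier_highPass l (x : L2(n))
    rw [hx] at h
    rw [h]
    filter_upwards [coeFn_indicatorOp (measurableSet_le_laplacianSymbol l) (𝓕 (x : L2(n)))]
      with ξ h1 h2
    rw [h1, indicator_of_notMem (by simpa using h2)]

theorem ofReal_norm_sq_eq_lintegral {X V : Type*} [MeasurableSpace X] {μ : Measure X}
    [NormedAddCommGroup V] (f : Lp V 2 μ) :
    ENNReal.ofReal (‖f‖ ^ 2) = ∫⁻ x, ENNReal.ofReal (‖f x‖ ^ 2) ∂μ := by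
  have h := Lp.enorm_def f
  rw [eLpNorm_eq_lintegral_rpow_enorm_toReal (by simp) (by simp)] at h
  rw [ENNReal.ofReal_pow (norm_nonneg _), ofReal_norm, h, ← ENNReal.rpow_natCast,
    ← ENNReal.rpow_mul]
  simp only [ENNReal.toReal_ofNat, Nat.cast_ofNat, ENNReal.rpow_ofNat]
  norm_num

/-- Π_l kills the high-pass part of f, so its norm is at most that of the low-frequency remainder.
Equality is not needed. -/
theorem norm_sq_spectralProj_laplacian_le (l : ℝ) (f : L2(n)) :
    ENNReal.ofReal (‖spectralProj (laplacian n) l f‖ ^ 2) ≤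
      ∫⁻ ξ in {ξ | laplacianSymbol ξ < l}, ENNReal.ofReal (‖(𝓕 f : L2(n)) ξ‖ ^ 2) := by
  have hm : MeasurableSet {ξ : EuclideanSpace ℝ (Fin n) | laplacianSymbol ξ < l} :=
    measurableSet_lt continuous_laplacianSymbol.measurable measurable_const
  have h := norm_spectralProj_le_norm_sub (f := f) (lowerCutoff_laplacian_highPass l f)
  rw [← Lp.norm_fourier_eq (f - highPass n l f), sub_eq_add_neg, FourierTransform.fourier_add,
    FourierTransform.fourier_neg, fourier_highPass, ← sub_eq_add_neg] at h
  refine (ENNReal.ofReal_le_ofReal (pow_le_pow_left₀ (norm_nonneg _) h 2)).trans ?_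
  rw [ofReal_norm_sq_eq_lintegral, ← lintegral_indicator hm]
  refine lintegral_mono_ae ?_
  filter_upwards [coeFn_indicatorOp (measurableSet_le_laplacianSymbol l) (𝓕 f : L2(n)),
    Lp.coeFn_sub (𝓕 f : L2(n)) (indicatorOp volume ℂ (measurableSet_le_laplacianSymbol l) (𝓕 f))]
    with ξ h1 h2
  rw [h2, Pi.sub_apply, h1]
  rcases lt_or_ge (laplacianSymbol ξ) l with h3 | h3
  · rw [indicator_of_mem (s := {ξ | laplacianSymbol ξ < l}) h3, indicator_of_notMem (by simpa using h3), sub_zero]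
  · rw [indicator_of_mem (s := {ξ | l ≤ laplacianSymbol ξ}) h3, sub_self]
    simp

theorem negForm_laplacian (f : L2(n)) : negForm (laplacian n) f = 0 := by
  refine le_antisymm ((negForm_le_lintegral _ f).trans ?_) zero_le
  rw [nonpos_iff_eq_zero, setLIntegral_eq_zero_iff' measurableSet_Ioi]
  · refine Filter.Eventually.of_forall fun t ht => ?_
    refine le_antisymm ((norm_sq_spectralProj_laplacian_le (-t) f).trans ?_) zero_le
    have : {ξ : EuclideanSpace ℝ (Fin n) | laplacianSymbol ξ < -t} = ∅ := by
      refine eq_empty_of_forall_notMem fun ξ (hξ : laplacianSymbol ξ < -t) => ?_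
      have ht' : 0 < t := ht
      linarith [laplacianSymbol_nonneg ξ]
    rw [this]
    simp
  · exact ((measurable_norm_sq_spectralProj _ f).comp measurable_neg).ennreal_ofReal.aemeasurable

theorem formEnergy_laplacian (f : L2(n)) :
    formEnergy (laplacian n) f = (posForm (laplacian n) f : EReal) := by
  rw [formEnergy, negForm_laplacian]
  simp

end Fourier

/-! ### Orthonormal families chosen from prescribed subspaces. -/

section Orthonormal

variable {H : Type*} [NormedAddCommGroup H] [InnerProductSpace ℂ H]

theorem exists_unit_orthogonal {N : ℕ} (v : Fin N → H) (L : Submodule ℂ H)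
    [FiniteDimensional ℂ L] (hL : N < Module.finrank ℂ L) :
    ∃ w ∈ L, ‖w‖ = 1 ∧ ∀ i, ⟪v i, w⟫_ℂ = 0 := by
  let φ : L →ₗ[ℂ] (Fin N → ℂ) :=
    LinearMap.pi fun i => (innerSL ℂ (v i)).toLinearMap ∘ₗ L.subtype
  have hφ : φ.ker ≠ ⊥ := LinearMap.ker_ne_bot_of_finrank_lt (by simpa using hL)
  obtain ⟨x, hx, hx0⟩ := Submodule.exists_mem_ne_zero_of_ne_bot hφ
  have hx0' : (x : H) ≠ 0 := fun h => hx0 (Subtype.ext h)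
  refine ⟨((‖(x : H)‖⁻¹ : ℝ) : ℂ) • (x : H), L.smul_mem _ x.2, ?_, fun i => ?_⟩
  · rw [norm_smul, Complex.norm_real, norm_inv, norm_norm,
      inv_mul_cancel₀ (norm_ne_zero_iff.2 hx0')]
  · have h : ⟪v i, (x : H)⟫_ℂ = 0 := congrFun (LinearMap.mem_ker.1 hx) i
    rw [inner_smul_right, h, mul_zero]

/-- Dimension count: N orthogonality conditions leave a unit vector in a space of dimension N + 1.
-/
theorem exists_orthonormal_mem (L : ℕ → Submodule ℂ H) (N : ℕ)
    (hf : ∀ k < N, FiniteDimensional ℂ (L k)) (hL : ∀ k < N, Module.finrank ℂ (L k) = k + 1) :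
    ∃ v : Fin N → H, Orthonormal ℂ v ∧ ∀ i : Fin N, v i ∈ L i := by
  induction N with
  | zero => exact ⟨Fin.elim0, ⟨fun i => i.elim0, fun i => i.elim0⟩, fun i => i.elim0⟩
  | succ N ih =>
    obtain ⟨v, ⟨hv1, hv2⟩, hvL⟩ := ih (fun k hk => hf k (hk.trans N.lt_succ_self))
      (fun k hk => hL k (hk.trans N.lt_succ_self))
    have := hf N N.lt_succ_self
    obtain ⟨w, hwL, hw1, hw⟩ := exists_unit_orthogonal v (L N)
      (by rw [hL N N.lt_succ_self]; exact N.lt_succ_self)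
    refine ⟨Fin.snoc v w, ⟨fun i => ?_, fun i j hij => ?_⟩, fun i => ?_⟩
    · refine Fin.lastCases ?_ (fun i => ?_) i
      · simpa using hw1
      · simpa using hv1 i
    · revert hij
      refine Fin.lastCases ?_ (fun i => ?_) i <;> refine Fin.lastCases ?_ (fun j => ?_) j
      · simp
      · intro _
        simp only [Fin.snoc_last, Fin.snoc_castSucc]
        rw [← inner_conj_symm, hw j, map_zero]
      · intro _
        simpa using hw i
      · intro hij
        simp only [Fin.snoc_castSucc]
        exact hv2 fun h => hij (by rw [h])
    · refine Fin.lastCases ?_ (fun i => ?_) i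
      · simpa using hwL
      · simpa using hvL i

end Orthonormal

/-! ### Phase-space bound and the eigenvalue sum. -/

section Fourier

open scoped SchwartzMap FourierTransform

variable {n : ℕ}

local notation "L2(" n ")" => Lp ℂ 2 (volume : Measure (EuclideanSpace ℝ (Fin n)))

theorem SupportedIn.integrable {Ω : Set (EuclideanSpace ℝ (Fin n))} (hΩ : MeasurableSet Ω)
    (hΩ' : volume Ω ≠ ∞) {f : L2(n)} (hf : SupportedIn Ω f) : Integrable f := by
  have : IsFiniteMeasure (volume.restrict Ω) := ⟨by simpa using hΩ'.lt_top⟩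
  have h : IntegrableOn f Ω := ((Lp.memLp f).restrict Ω).integrable (by norm_num)
  refine ((integrable_indicator_iff hΩ).2 h).congr ?_
  filter_upwards [hf] with x hx
  by_cases hxΩ : x ∈ Ω
  · rw [indicator_of_mem hxΩ]
  · rw [indicator_of_notMem hxΩ, hx hxΩ]

/-- Identifies the L² transform with the Fourier integral by moving both onto test functions, so
that it can be evaluated pointwise. -/
theorem fourier_ae_eq_of_integrable {f : L2(n)} (hf : Integrable f) :
    ∀ᵐ ξ, (𝓕 f : L2(n)) ξ = 𝓕 (f : EuclideanSpace ℝ (Fin n) → ℂ) ξ := by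
  have hc : Continuous (𝓕 (f : EuclideanSpace ℝ (Fin n) → ℂ)) :=
    VectorFourier.fourierIntegral_continuous Real.continuous_fourierChar
      (L := innerₗ (EuclideanSpace ℝ (Fin n))) continuous_inner hf
  refine ae_eq_of_integral_contDiff_smul_eq ((Lp.memLp _).locallyIntegrable (by norm_num))
    hc.locallyIntegrable fun φ hφ hcs => ?_
  have hg₁ : HasCompactSupport (Complex.ofRealCLM ∘ φ) := hcs.comp_left rfl
  have hg₂ : ContDiff ℝ ((⊤ : ℕ∞) : WithTop ℕ∞) (Complex.ofRealCLM ∘ φ) := by fun_prop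
  have h1 := congrArg (fun T => T (hg₁.toSchwartzMap hg₂)) (Lp.fourier_toTemperedDistribution_eq f)
  simp only [TemperedDistribution.fourier_apply, Lp.toTemperedDistribution_apply] at h1
  have h2 := VectorFourier.integral_fourierIntegral_smul_eq_flip
    (L := innerₗ (EuclideanSpace ℝ (Fin n))) Real.continuous_fourierChar continuous_inner
    (hg₁.toSchwartzMap hg₂).integrable (μ := volume) (ν := volume) hf
  rw [flip_innerₗ] at h2
  have h3 : ∫ x, (hg₁.toSchwartzMap hg₂) x • (𝓕 f : L2(n)) x =
      ∫ x, (hg₁.toSchwartzMap hg₂) x • 𝓕 (f : EuclideanSpace ℝ (Fin n) → ℂ) x :=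
    h1.symm.trans h2
  simpa using h3

/-- At ξ the transforms are the inner products of the v_i with χ_Ω e^{2πi⟨x, ξ⟩}, whose squared norm
is vol(Ω); Bessel concludes. -/
theorem sum_norm_sq_fourier_le {Ω : Set (EuclideanSpace ℝ (Fin n))} (hΩ : MeasurableSet Ω)
    (hΩ' : volume Ω ≠ ∞) {N : ℕ} {v : Fin N → L2(n)} (hv : Orthonormal ℂ v)
    (hs : ∀ i, SupportedIn Ω (v i)) :
    ∀ᵐ ξ, ∑ i, ENNReal.ofReal (‖(𝓕 (v i) : L2(n)) ξ‖ ^ 2) ≤ volume Ω := by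
  filter_upwards [ae_all_iff.2 fun i => fourier_ae_eq_of_integrable ((hs i).integrable hΩ hΩ')]
    with ξ hξ
  have hm : MemLp (Ω.indicator fun x => ((Real.fourierChar (inner ℝ x ξ) : Circle) : ℂ)) 2
      (volume : Measure (EuclideanSpace ℝ (Fin n))) := by
    rw [memLp_indicator_iff_restrict hΩ]
    have : IsFiniteMeasure (volume.restrict Ω) := ⟨by simpa using hΩ'.lt_top⟩
    refine MemLp.of_bound (C := 1) ?_ (Filter.Eventually.of_forall fun x => (Circle.norm_coe _).le)
    exact Continuous.aestronglyMeasurable (by fun_prop)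
  have h1 : ∀ i, (𝓕 (v i) : L2(n)) ξ = ⟪hm.toLp, v i⟫_ℂ := by
    intro i
    rw [hξ, Real.fourier_eq, L2.inner_def]
    refine integral_congr_ae ?_
    filter_upwards [hm.coeFn_toLp, hs i] with x h2 h3
    rw [h2]
    by_cases hx : x ∈ Ω
    · rw [indicator_of_mem hx, RCLike.inner_apply, mul_comm, Circle.smul_def, smul_eq_mul,
        AddChar.map_neg_eq_inv, Circle.coe_inv_eq_conj]
    · rw [indicator_of_notMem hx, h3 hx, inner_zero_left, smul_zero]
  have h2 : ENNReal.ofReal (‖hm.toLp‖ ^ 2) = volume Ω := by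
    rw [ofReal_norm_sq_eq_lintegral, ← setLIntegral_one, ← lintegral_indicator hΩ]
    refine lintegral_congr_ae ?_
    filter_upwards [hm.coeFn_toLp] with x h2
    rw [h2]
    by_cases hx : x ∈ Ω
    · rw [indicator_of_mem hx, indicator_of_mem hx, Circle.norm_coe]
      simp
    · simp [indicator_of_notMem hx]
  rw [← ENNReal.ofReal_sum_of_nonneg fun i _ => by positivity, ← h2]
  refine ENNReal.ofReal_le_ofReal ?_
  simp_rw [h1, norm_inner_symm hm.toLp]
  exact hv.sum_inner_products_le hm.toLp

theorem volume_laplacianSymbol_lt {t : ℝ} (ht : 0 < t) :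
    volume {ξ : EuclideanSpace ℝ (Fin n) | laplacianSymbol ξ < t} =
      ENNReal.ofReal (((2 * Real.pi) ^ n)⁻¹ *
        volume.real (Metric.ball (0 : EuclideanSpace ℝ (Fin n)) 1) * t ^ (n / 2 : ℝ)) := by
  have hs : {ξ : EuclideanSpace ℝ (Fin n) | laplacianSymbol ξ < t} =
      Metric.ball 0 (√t / (2 * Real.pi)) := by
    ext ξ
    have hp : 0 < 2 * Real.pi := by positivity
    rw [mem_ball_zero_iff, lt_div_iff₀ hp, Real.lt_sqrt (by positivity)]
    simp only [laplacianSymbol, mem_ofPred_eq]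
    rw [mul_pow ‖ξ‖, mul_comm]
  rw [hs, Measure.addHaar_ball_of_pos volume _ (by positivity), finrank_euclideanSpace_fin,
    ← ENNReal.ofReal_toReal (measure_ball_lt_top (μ := volume)
      (x := (0 : EuclideanSpace ℝ (Fin n))) (r := 1)).ne, ← ENNReal.ofReal_mul (by positivity)]
  congr 1
  have h : √t ^ n = t ^ (n / 2 : ℝ) := by
    rw [Real.sqrt_eq_rpow, ← Real.rpow_natCast, ← Real.rpow_mul ht.le]
    congr 1
    ring
  rw [div_pow, h, Measure.real]
  ring

theorem sum_norm_sq_spectralProj_le {Ω : Set (EuclideanSpace ℝ (Fin n))} (hΩ : MeasurableSet Ω)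
    (hΩ' : volume Ω ≠ ∞) {N : ℕ} {v : Fin N → L2(n)} (hv : Orthonormal ℂ v)
    (hs : ∀ i, SupportedIn Ω (v i)) {t : ℝ} (ht : 0 < t) :
    ∑ i, ‖spectralProj (laplacian n) t (v i)‖ ^ 2 ≤ ((2 * Real.pi) ^ n)⁻¹ *
        volume.real (Metric.ball (0 : EuclideanSpace ℝ (Fin n)) 1) * volume.real Ω *
          t ^ (n / 2 : ℝ) := by
  rw [← ENNReal.ofReal_le_ofReal_iff (by positivity),
    ENNReal.ofReal_sum_of_nonneg fun i _ => by positivity]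
  refine (Finset.sum_le_sum fun i _ => norm_sq_spectralProj_laplacian_le t (v i)).trans ?_
  rw [← lintegral_finsetSum' _ fun i _ => by
    exact ((Lp.aestronglyMeasurable _).norm.aemeasurable.pow_const 2).ennreal_ofReal.restrict]
  refine (lintegral_mono_ae (ae_restrict_of_ae (sum_norm_sq_fourier_le hΩ hΩ' hv hs))).trans ?_
  rw [setLIntegral_const, volume_laplacianSymbol_lt ht, ← ENNReal.ofReal_toReal hΩ',
    ← ENNReal.ofReal_mul (by positivity)]
  refine ENNReal.ofReal_le_ofReal (le_of_eq ?_)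
  rw [Measure.real, Measure.real]
  ring

/-- The upper limit is the zero of the integrand. -/
theorem integral_sub_mul_rpow {c p : ℝ} (hc : 0 < c) (hp : 0 < p) {N : ℝ} (hN : 0 ≤ N) :
    ∫ t in (0 : ℝ)..(N / c) ^ p⁻¹, (N - c * t ^ p) =
      p / (p + 1) * c ^ (-p⁻¹) * N ^ (1 + p⁻¹) := by
  rw [intervalIntegral.integral_sub (by simp)
    ((intervalIntegral.intervalIntegrable_rpow' (by linarith)).const_mul c),
    intervalIntegral.integral_const, intervalIntegral.integral_const_mul,
    integral_rpow (Or.inl (by linarith))]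
  rcases hN.eq_or_lt with rfl | hN
  · have h1 : (1 + p⁻¹) ≠ 0 := by positivity
    have h2 : p + 1 ≠ 0 := by positivity
    simp [Real.zero_rpow h1, Real.zero_rpow h2, Real.zero_rpow (inv_ne_zero hp.ne')]
  have hT : 0 < (N / c) ^ p⁻¹ := by positivity
  have hTp : ((N / c) ^ p⁻¹) ^ p = N / c := by
    rw [← Real.rpow_mul (by positivity), inv_mul_cancel₀ hp.ne', Real.rpow_one]
  rw [Real.rpow_add hT, hTp, Real.rpow_one, Real.zero_rpow (by positivity), Real.rpow_add hN,
    Real.rpow_one, Real.rpow_neg hc.le, Real.div_rpow hN.le hc.le]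
  have : 0 < c ^ p⁻¹ := by positivity
  simp only [smul_eq_mul]
  field_simp
  ring

theorem le_sum_posForm_laplacian (hn : 1 ≤ n) {Ω : Set (EuclideanSpace ℝ (Fin n))}
    (hΩ : MeasurableSet Ω) (hΩ0 : volume Ω ≠ 0) (hΩ' : volume Ω ≠ ∞) {N : ℕ} {v : Fin N → L2(n)}
    (hv : Orthonormal ℂ v) (hs : ∀ i, SupportedIn Ω (v i)) :
    ENNReal.ofReal ((n : ℝ) / (n + 2) *
      (((2 * Real.pi) ^ n)⁻¹ * volume.real (Metric.ball (0 : EuclideanSpace ℝ (Fin n)) 1) *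
        volume.real Ω) ^ (-(2 / n : ℝ)) * (N : ℝ) ^ (1 + 2 / n : ℝ)) ≤
      ∑ i, posForm (laplacian n) (v i) := by
  have hb : 0 < volume.real (Metric.ball (0 : EuclideanSpace ℝ (Fin n)) 1) :=
    ENNReal.toReal_pos (Metric.measure_ball_pos volume _ one_pos).ne' measure_ball_lt_top.ne
  have hw : 0 < volume.real Ω := ENNReal.toReal_pos hΩ0 hΩ'
  set c := ((2 * Real.pi) ^ n)⁻¹ * volume.real (Metric.ball (0 : EuclideanSpace ℝ (Fin n)) 1) *
        volume.real Ω with hcdef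
  have hc : 0 < c := by positivity
  have hn' : (0 : ℝ) < n := by exact_mod_cast hn
  set p : ℝ := n / 2 with hpdef
  have hp : 0 < p := by positivity
  have hpi : (2 / n : ℝ) = p⁻¹ := by rw [hpdef, inv_div]
  have hpp : (n : ℝ) / (n + 2) = p / (p + 1) := by rw [hpdef]; field_simp
  rw [hpi, hpp, ← integral_sub_mul_rpow hc hp N.cast_nonneg]
  set T := ((N : ℝ) / c) ^ p⁻¹ with hT
  have hT0 : 0 ≤ T := by positivity
  have hTp : T ^ p = N / c := by
    rw [hT, ← Real.rpow_mul (by positivity), inv_mul_cancel₀ hp.ne', Real.rpow_one]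
  have hint : IntervalIntegrable (fun t : ℝ => N - c * t ^ p) volume 0 T :=
    intervalIntegrable_const.sub
      ((intervalIntegral.intervalIntegrable_rpow' (by linarith)).const_mul c)
  rw [intervalIntegral.integral_of_le hT0, ofReal_integral_eq_lintegral_ofReal hint.1]
  · refine le_trans ?_ (Finset.sum_le_sum fun i _ =>
      lintegral_le_posForm (isSelfAdjoint_laplacian n) (v i))
    rw [← lintegral_finsetSum' _ fun i _ => by
      exact (measurable_const.sub
        (measurable_norm_sq_spectralProj _ _)).ennreal_ofReal.aemeasurable]
    -- Beyond T the lower bound N - c t^p is negative, so that range is discarded.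
    refine le_trans (setLIntegral_mono' measurableSet_Ioc fun t ht => ?_)
      (lintegral_mono_set Ioc_subset_Ioi_self)
    rw [← ENNReal.ofReal_sum_of_nonneg fun i _ => by
      exact sub_nonneg.2 (pow_le_pow_left₀ (norm_nonneg _) (norm_spectralProj_apply_le _ _ _) 2)]
    refine ENNReal.ofReal_le_ofReal ?_
    rw [Finset.sum_sub_distrib]
    have h1 := sum_norm_sq_spectralProj_le hΩ hΩ' hv hs ht.1
    have h2 : ∑ i, ‖v i‖ ^ 2 = (N : ℝ) := by simp [hv.1]
    rw [h2]
    exact sub_le_sub_left h1 _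
  · refine (ae_restrict_iff' measurableSet_Ioc).2 (Filter.Eventually.of_forall fun t ht => ?_)
    have h1 : t ^ p ≤ N / c := hTp ▸ Real.rpow_le_rpow ht.1.le ht.2 hp.le
    have h2 : c * t ^ p ≤ N := by
      rw [mul_comm]
      exact (le_div_iff₀ hc).1 h1
    exact sub_nonneg.2 h2

theorem coe_ennreal_sum {ι : Type*} (s : Finset ι) (f : ι → ℝ≥0∞) :
    ∑ i ∈ s, (f i : EReal) = ((∑ i ∈ s, f i : ℝ≥0∞) : EReal) := by
  classical
  induction s using Finset.induction_on with
  | empty => simp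
  | insert a s ha ih => rw [Finset.sum_insert ha, Finset.sum_insert ha, ih, EReal.coe_ennreal_add]

/-- For k ≥ 1 every trial space has a unit vector; for k = 0 the supremum would be over the empty
set, hence ⊥. -/
theorem dirichletEigenvalue_laplacian_nonneg (Ω : Set (EuclideanSpace ℝ (Fin n))) {k : ℕ}
    (hk : 1 ≤ k) : 0 ≤ dirichletEigenvalue (laplacian n) Ω k := by
  refine le_iInf₂ fun L hL => ?_
  have := hL.1
  obtain ⟨w, hwL, hw, -⟩ := exists_unit_orthogonal (Fin.elim0 : Fin 0 → L2(n)) L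
    (by rw [hL.2.1]; exact hk)
  refine le_trans ?_ (le_iSup₂ (f := fun f _ => formEnergy (laplacian n) f) w ⟨hwL, hw⟩)
  rw [formEnergy_laplacian]
  exact EReal.coe_ennreal_nonneg _

theorem sum_dirichletEigenvalue_laplacian_ge (hn : 1 ≤ n) {Ω : Set (EuclideanSpace ℝ (Fin n))}
    (hΩ : MeasurableSet Ω) (hΩ0 : volume Ω ≠ 0) (hΩ' : volume Ω ≠ ∞) (N : ℕ) :
    (((n : ℝ) / (n + 2) *
      (((2 * Real.pi) ^ n)⁻¹ * volume.real (Metric.ball (0 : EuclideanSpace ℝ (Fin n)) 1) *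
        volume.real Ω) ^ (-(2 / n : ℝ)) * (N : ℝ) ^ (1 + 2 / n : ℝ) : ℝ) : EReal) ≤
      ∑ k ∈ Finset.Icc 1 N, dirichletEigenvalue (laplacian n) Ω k := by
  set ℓ : ℕ → ℝ≥0∞ := fun k => (dirichletEigenvalue (laplacian n) Ω k).toENNReal with hℓ
  have h1 : ∑ k ∈ Finset.Icc 1 N, dirichletEigenvalue (laplacian n) Ω k =
      ((∑ k : Fin N, ℓ (k + 1) : ℝ≥0∞) : EReal) := by
    rw [Fin.sum_univ_eq_sum_range (fun k => ℓ (k + 1)), Finset.range_eq_Ico,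
      Finset.sum_Ico_add' ℓ, zero_add, Finset.Ico_add_one_right_eq_Icc,
      ← coe_ennreal_sum]
    refine Finset.sum_congr rfl fun k hk => ?_
    rw [hℓ, EReal.coe_toENNReal (dirichletEigenvalue_laplacian_nonneg Ω (Finset.mem_Icc.1 hk).1)]
  rw [h1]
  refine (EReal.coe_le_coe_iff.2 (le_max_left _ 0)).trans ?_
  rw [← EReal.coe_ennreal_ofReal, EReal.coe_ennreal_le_coe_ennreal_iff]
  by_cases htop : ∑ k : Fin N, ℓ (k + 1) = ∞
  · rw [htop]; exact le_top
  have hfin : ∀ k < N, ℓ (k + 1) ≠ ∞ := fun k hk h =>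
    htop (ENNReal.sum_eq_top.2 ⟨⟨k, hk⟩, Finset.mem_univ _, h⟩)
  -- The infimum over trial spaces need not be attained, hence a slack δ for each eigenvalue.
  have key : ∀ δ : ℝ≥0∞, δ ≠ 0 → ENNReal.ofReal ((n : ℝ) / (n + 2) *
      (((2 * Real.pi) ^ n)⁻¹ * volume.real (Metric.ball (0 : EuclideanSpace ℝ (Fin n)) 1) *
        volume.real Ω) ^ (-(2 / n : ℝ)) * (N : ℝ) ^ (1 + 2 / n : ℝ)) ≤
        ∑ k : Fin N, ℓ (k + 1) + N * δ := by
    intro δ hδ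
    have hex : ∀ k, ∃ L : Submodule ℂ (L2(n)), k < N → L ∈ trialSpaces (laplacian n) Ω (k + 1) ∧
        ∀ f ∈ L, ‖f‖ = 1 → posForm (laplacian n) f ≤ ℓ (k + 1) + δ := by
      intro k
      by_cases hk : k < N
      · have hlt : dirichletEigenvalue (laplacian n) Ω (k + 1) <
            ((ℓ (k + 1) + δ : ℝ≥0∞) : EReal) := by
          rw [← EReal.coe_toENNReal (dirichletEigenvalue_laplacian_nonneg Ω (Nat.le_add_left 1 k)),
            EReal.coe_ennreal_lt_coe_ennreal_iff]
          exact ENNReal.lt_add_right (hfin k hk) hδ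
        obtain ⟨L, hL, hlt'⟩ := by
          simpa only [dirichletEigenvalue, iInf_lt_iff] using hlt
        refine ⟨L, fun _ => ⟨hL, fun f hf hf1 => ?_⟩⟩
        have h := (le_iSup₂ (f := fun f _ => formEnergy (laplacian n) f) f ⟨hf, hf1⟩).trans hlt'.le
        rwa [formEnergy_laplacian, EReal.coe_ennreal_le_coe_ennreal_iff] at h
      · exact ⟨⊥, fun h => absurd h hk⟩
    choose L hL using hex
    obtain ⟨v, hv, hvL⟩ := exists_orthonormal_mem L N (fun k hk => (hL k hk).1.1)
      (fun k hk => (hL k hk).1.2.1)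
    refine (le_sum_posForm_laplacian hn hΩ hΩ0 hΩ' hv
      fun i => ((hL i i.2).1.2.2 _ (hvL i)).1).trans ?_
    refine (Finset.sum_le_sum fun (i : Fin N) _ => (hL i i.2).2 _ (hvL i) (hv.1 i)).trans (le_of_eq ?_)
    rw [Finset.sum_add_distrib]
    simp
  refine ENNReal.le_of_forall_pos_le_add fun ε hε _ => ?_
  -- For N = 0 the slack ε / N is ∞, but N * δ is still 0.
  refine (key (ε / N) ?_).trans (add_le_add le_rfl ENNReal.mul_div_le)
  exact (ENNReal.div_pos (by simpa using hε.ne') (ENNReal.natCast_ne_top N)).ne'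

end Fourier

end ConfinedState

end

open ConfinedState in
theorem mainTheorem2 :
    (∀ {X : Type*} [MeasurableSpace X] (μ : Measure X) [SigmaFinite μ]
      {V : Type*} [NormedAddCommGroup V] [InnerProductSpace ℂ V] [CompleteSpace V]
      [TopologicalSpace.SeparableSpace V]
      (A : Lp V 2 μ →ₗ.[ℂ] Lp V 2 μ), IsSelfAdjoint A →
      ∀ (Ω : Set X) (hΩ : MeasurableSet Ω) (ρ : Lp V 2 μ →L[ℂ] Lp V 2 μ),
        IsState ρ → ρ ≠ 0 → IsConfined Ω ρ → posEnergy A ρ ≠ ∞ →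
        posInvIntegral (spectralCount A hΩ) ((trace ρ).toReal / ‖ρ‖) ≠ ∞ ∧
        (‖ρ‖ : EReal) * invIntegral (spectralCount A hΩ) ((trace ρ).toReal / ‖ρ‖)
          ≤ energy A ρ) ∧
    (∀ (n : ℕ), 1 ≤ n → IsSelfAdjoint (laplacian n) ∧
      ∀ (Ω : Set (EuclideanSpace ℝ (Fin n))), MeasurableSet Ω → volume Ω ≠ 0 → volume Ω ≠ ∞ →
      ∀ N : ℕ,
        (((n : ℝ) / (n + 2) *
          (((2 * Real.pi) ^ n)⁻¹ *
            volume.real (Metric.ball (0 : EuclideanSpace ℝ (Fin n)) 1) * volume.real Ω)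
              ^ (-(2 / n : ℝ)) *
          (N : ℝ) ^ (1 + 2 / n : ℝ) : ℝ) : EReal)
        ≤ ∑ k ∈ Finset.Icc 1 N, dirichletEigenvalue (laplacian n) Ω k) := by
  refine ⟨?_, fun n hn => ⟨isSelfAdjoint_laplacian n, fun Ω hΩ h0 hfin N =>
    sum_dirichletEigenvalue_laplacian_ge hn hΩ h0 hfin N⟩⟩
  intro X _ μ _ V _ _ _ _ A hA Ω hΩ ρ hρ h0 hc hE
  exact norm_mul_invIntegral_le_energy hΩ hA hρ h0 hc hE
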